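/- **Theorem 10.3.** Let $q\in L^\infty((0,\infty))$ be real-valued. A *Weyl solution* at $z\in\mathbb C$ is a solution $u=u(\cdot,z)\not\equiv 0$ of $-u''+qu=zu$ on $[0,\infty)$ ($u$ and $u'$ locally absolutely continuous, the equation holding almost everywhere) with $\int_0^\infty|u(x)|^2\,dx<\infty$. The principal Weyl–Titchmarsh function of $-\frac{d^2}{dx^2}+q$ in $L^2((0,\infty))$ is $m(z)=u'(0_+,z)/u(0_+,z)$, with $u(\cdot,z)$ a Weyl solution. An $A$-amplitude of $q$ is a real-valued function $A$ on $(0,\infty)$ with $A\in L^1((0,a))$ for all $a>0$ such that, for all $a>0$ and $\varepsilon>0$, $$m(-\kappa^2)=-\kappa-\int_0^a A(\alpha)e^{-2\alpha\kappa}\,d\alpha+\tilde O(e^{-2a\kappa})$$ as $|\kappa|\to\infty$ with $-\frac{\pi}{2}+\varepsilon<\arg(\kappa)<-\varepsilon$, where $f=\tilde O(g)$ means that $g\to0$ and $(f/g)|g|^{\delta}\to0$ for all $\delta>0$. Then $q$ has an $A$-amplitude. Moreover, for every $A$-amplitude $A$ of $q$ and every real $\kappa>0$ with $\kappa^2>\|q\|_\infty$: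 a Weyl solution at $-\kappa^2$ exists, every such solution satisfies $u(0_+)\neq0$ and has the same quotient $u'(0_+)/u(0_+)=m(-\kappa^2)$, the function $m$ is analytic at $-\kappa^2$ (so that $m(-\kappa^2)$ is the value of the analytic continuation of $m$ from the upper half plane), the integral $\int_0^\infty A(\alpha)e^{-2\alpha\kappa}\,d\alpha$ converges absolutely, and $$m(-\kappa^2)=-\kappa-\int_0^\infty A(\alpha)e^{-2\alpha\kappa}\,d\alpha,$$ with no error term. -/

import Mathlib

open Set Filter Topology MeasureTheory

noncomputable section

namespace Schrodinger

/-- `u`, with derivative `u'`, is a Weyl solution on the half-line `[0, ∞)` at the energy `z`: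
a solution of `-u'' + q u = z u` that is not identically zero and is square integrable at infinity.
Here `u` is differentiable on `[0, ∞)` (one-sided at `0`) and `u'` is locally absolutely
continuous with `(u')' = (q - z) u` almost everywhere, written in integrated form (the potential
`q` is supposed to be locally integrable on `[0, ∞)`).
Values of `u`, `u'`, `q` on `(-∞, 0)` play no role. -/
structure IsWeylSolution (q : ℝ → ℝ) (z : ℂ) (u u' : ℝ → ℂ) : Prop where
  hasDeriv : ∀ x ∈ Ici (0 : ℝ), HasDerivWithinAt u (u' x) (Ici 0) x
  equation : ∀ x ∈ Ici (0 : ℝ), u' x = u' 0 + ∫ t in (0 : ℝ)..x, ((q t : ℂ) - z) * u t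
  nonzero : ∃ x ∈ Ici (0 : ℝ), u x ≠ 0
  memLp : MemLp u 2 (volume.restrict (Ioi (0 : ℝ)))

open Classical in
/-- The principal Weyl-Titchmarsh function `m(z) = u'(0₊, z) / u(0₊, z)` of `-d²/dx² + q` in
`L²((0, ∞))`, where `u(·, z)` is a Weyl solution at `z`, for `q` in the limit point case at
infinity. In that case the Weyl solution is unique up to a factor, so that the choice of it does not
matter. (Where there is no Weyl solution the value is `0` by convention.) -/
def weylM (q : ℝ → ℝ) (z : ℂ) : ℂ :=
  if h : ∃ p : (ℝ → ℂ) × (ℝ → ℂ), IsWeylSolution q z p.1 p.2 then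
    h.choose.2 0 / h.choose.1 0
  else 0

/-- `f = Õ(g)` along the filter `l`: `g → 0`, and `(f / g) |g| ^ ε → 0` for all `ε > 0`. -/
def IsOTilde (l : Filter ℂ) (f g : ℂ → ℂ) : Prop :=
  Tendsto g l (𝓝 0) ∧
    ∀ ε : ℝ, 0 < ε → Tendsto (fun κ => f κ / g κ * ((‖g κ‖ ^ ε : ℝ) : ℂ)) l (𝓝 0)

/-- The filter of `|κ| → ∞` in the sector `-π/2 + ε < arg κ < -ε`. For these `κ` the point `-κ²`
lies in the upper half plane. -/
def sectorAtInfinity (ε : ℝ) : Filter ℂ :=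
  Bornology.cobounded ℂ ⊓ 𝓟 {κ : ℂ | -(Real.pi / 2) + ε < κ.arg ∧ κ.arg < -ε}

/-- `A` is the `A`-amplitude of the potential `q` on `(0, ∞)`: it is integrable on every bounded
interval `(0, a)`, and for all `a > 0` and `ε > 0`
`m(-κ²) = -κ - ∫₀ᵃ A(α) e^{-2ακ} dα + Õ(e^{-2aκ})`
as `|κ| → ∞` in the sector `-π/2 + ε < arg κ < -ε`. These properties determine `A` almost
everywhere. -/
structure IsAAmplitude (q : ℝ → ℝ) (A : ℝ → ℝ) : Prop where
  integrable : ∀ a : ℝ, 0 < a → IntegrableOn A (Ioo 0 a)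
  asymptotics : ∀ a : ℝ, 0 < a → ∀ ε : ℝ, 0 < ε →
    IsOTilde (sectorAtInfinity ε)
      (fun κ => weylM q (-κ ^ 2) -
        (-κ - ∫ α in (0 : ℝ)..a, (A α : ℂ) * Complex.exp (-2 * (α : ℂ) * κ)))
      (fun κ => Complex.exp (-2 * (a : ℂ) * κ))

end Schrodinger

end

/-!
Put `Q = ‖q‖∞` and take `q` bounded by `Q` everywhere. The amplitudes of the translates
`q(x + ·)` solve the evolution equation `∂A/∂x = ∂A/∂α + A * A` (convolution in `α`) with
`A(0₊, x) = q(x)`. Integrating along characteristics and iterating, one finds that the increments of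
the Picard iterates are dominated by those of the iterates for the constant potential `-Q`. The
Laplace transforms `∫ M(α) e^{-2aα} dα` of these majorants stay below the smaller root
`a - √(a² - Q)` of `2an = Q + n²`, as long as `a > √Q`. So the iterates converge to a function
`A(α, x)` whose Laplace transform `n(x, κ) = ∫ A(α, x) e^{-2ακ} dα` converges absolutely for
`Re κ > √Q`, satisfies `|n| < Re κ`, and solves the Riccati equation `n' = 2κn + n² - q`. Therefore
`u = exp(-κx - ∫₀ˣ n)` is an exponentially decaying solution at `-κ²`. It has no zeros and `u'` is
square integrable, so every Weyl solution is a multiple of it, and `m(-κ²) = -κ - n(0, κ)` without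
an error term.

The tails of this Laplace integral are `O(e^{-2aκ})`, so `A(·, 0)` is an `A`-amplitude. If `A'` is
another one, then `e^{2bκ} ∫₀ᵇ (A - A')(α) e^{-2ακ} dα` is bounded on a ray in the sector. It is an
entire function of exponential type, real on the real axis and bounded in the left half-plane, so by
Phragmén-Lindelöf and Liouville it is constant, by Riemann-Lebesgue it is `0`, and `A' = A` almost
everywhere.
-/

noncomputable section

namespace Schrodinger

open scoped ENNReal NNReal

section Norm

lemma enorm_complex_ofReal (r : ℝ) : ‖(r : ℂ)‖ₑ = ‖r‖ₑ := by
  rw [← ofReal_norm, Complex.norm_real, ofReal_norm]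

lemma norm_complex_ofReal_le_of_enorm_le {r : ℝ} {Q : ℝ≥0} (h : ‖r‖ₑ ≤ Q) : ‖(r : ℂ)‖ ≤ Q := by
  rw [Complex.norm_real]
  exact_mod_cast enorm_le_coe.1 h

end Norm

section LaplaceTransform

/-- The kernel `e^{-2ακ}` of the Laplace transform, in the normalisation of `A`-amplitudes. -/
def laplaceKernel (κ : ℂ) (α : ℝ) : ℂ := Complex.exp (-2 * (α : ℂ) * κ)

/-- The two-sided Laplace transform `κ ↦ ∫ f(α) e^{-2ακ} dα`. The transform over `(0, ∞)` is that of
a function vanishing on `(-∞, 0]`. -/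
def laplace (f : ℝ → ℂ) (κ : ℂ) : ℂ := ∫ α, f α * laplaceKernel κ α

variable {κ : ℂ} {f : ℝ → ℂ}

lemma continuous_laplaceKernel (κ : ℂ) : Continuous (laplaceKernel κ) := by
  unfold laplaceKernel; fun_prop

@[fun_prop]
lemma measurable_laplaceKernel (κ : ℂ) : Measurable (laplaceKernel κ) :=
  (continuous_laplaceKernel κ).measurable

lemma laplaceKernel_zero (κ : ℂ) : laplaceKernel κ 0 = 1 := by simp [laplaceKernel]

lemma laplaceKernel_add (κ : ℂ) (s t : ℝ) :
    laplaceKernel κ (s + t) = laplaceKernel κ s * laplaceKernel κ t := by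
  rw [laplaceKernel, laplaceKernel, laplaceKernel, ← Complex.exp_add]
  push_cast
  ring_nf

lemma laplaceKernel_neg_mul_cancel (κ : ℂ) (t : ℝ) :
    laplaceKernel κ (-t) * laplaceKernel κ t = 1 := by
  rw [← laplaceKernel_add, neg_add_cancel, laplaceKernel_zero]

lemma norm_laplaceKernel (κ : ℂ) (α : ℝ) : ‖laplaceKernel κ α‖ = Real.exp (-2 * α * κ.re) := by
  simp [laplaceKernel, Complex.norm_exp]

lemma enorm_laplaceKernel_ne_zero (κ : ℂ) (α : ℝ) : ‖laplaceKernel κ α‖ₑ ≠ 0 :=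
  enorm_ne_zero.2 (Complex.exp_ne_zero _)

lemma hasDerivAt_laplaceKernel (κ : ℂ) (α : ℝ) :
    HasDerivAt (laplaceKernel κ) (-2 * κ * laplaceKernel κ α) α := by
  have h : HasDerivAt (fun t : ℝ => -2 * (t : ℂ) * κ) (-2 * κ) α := by
    simpa using ((Complex.ofRealCLM.hasDerivAt (x := α)).const_mul (-2)).mul_const κ
  exact h.cexp.congr_deriv (mul_comm _ _)

lemma integrableOn_laplaceKernel (hκ : 0 < κ.re) (a : ℝ) :
    IntegrableOn (laplaceKernel κ) (Ioi a) := by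
  refine (integrable_norm_iff (continuous_laplaceKernel κ).aestronglyMeasurable).1 ?_
  refine (exp_neg_integrableOn_Ioi a (b := 2 * κ.re) (by positivity)).congr_fun (fun t _ => ?_)
    measurableSet_Ioi
  rw [norm_laplaceKernel]
  ring_nf

lemma integrableOn_laplaceKernel_mul (hκ : 0 < κ.re) {g : ℝ → ℂ} (hg : Measurable g) {C : ℝ}
    (hC : ∀ t, ‖g t‖ ≤ C) (a : ℝ) : IntegrableOn (fun t => laplaceKernel κ t * g t) (Ioi a) :=
  (integrableOn_laplaceKernel hκ a).mul_bdd (c := C) hg.aestronglyMeasurable (ae_of_all _ hC)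

lemma lintegral_enorm_laplaceKernel (hκ : 0 < κ.re) :
    ∫⁻ t in Ioi (0 : ℝ), ‖laplaceKernel κ t‖ₑ = ENNReal.ofReal (2 * κ.re)⁻¹ := by
  rw [← ofReal_integral_norm_eq_lintegral_enorm (integrableOn_laplaceKernel hκ 0)]
  simp_rw [norm_laplaceKernel, fun t : ℝ => show -2 * t * κ.re = -(2 * κ.re) * t by ring]
  rw [integral_exp_mul_Ioi (by linarith)]
  simp

lemma integrable_mul_laplaceKernel {M : ℝ → ℝ≥0∞} (hf : AEStronglyMeasurable f)
    (hfM : ∀ᵐ α, ‖f α‖ₑ ≤ M α) (hM : ∫⁻ α, M α * ‖laplaceKernel κ α‖ₑ ≠ ⊤) :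
    Integrable fun α => f α * laplaceKernel κ α := by
  refine ⟨hf.mul (continuous_laplaceKernel κ).aestronglyMeasurable, ?_⟩
  refine (lintegral_mono_ae (hfM.mono fun α h => ?_)).trans_lt hM.lt_top
  rw [enorm_mul]
  gcongr

lemma enorm_laplace_le {M : ℝ → ℝ≥0∞} (hfM : ∀ᵐ α, ‖f α‖ₑ ≤ M α) :
    ‖laplace f κ‖ₑ ≤ ∫⁻ α, M α * ‖laplaceKernel κ α‖ₑ := by
  refine (enorm_integral_le_lintegral_enorm _).trans (lintegral_mono_ae (hfM.mono fun α h => ?_))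
  rw [enorm_mul]
  gcongr

lemma laplace_comp_sub_right (f : ℝ → ℂ) (κ : ℂ) (c : ℝ) :
    laplace (fun α => f (α - c)) κ = laplaceKernel κ c * laplace f κ := by
  have shift : ∀ α, f (α - c) * laplaceKernel κ α =
      laplaceKernel κ c * (f (α - c) * laplaceKernel κ (α - c)) := fun α => by
    rw [mul_left_comm, ← laplaceKernel_add, add_sub_cancel]
  simp_rw [laplace, shift]
  rw [integral_const_mul, integral_sub_right_eq_self fun α => f α * laplaceKernel κ α]

lemma lintegral_comp_sub_mul_enorm_laplaceKernel (M : ℝ → ℝ≥0∞) (κ : ℂ) (c : ℝ) :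
    ∫⁻ α, M (α - c) * ‖laplaceKernel κ α‖ₑ =
      ‖laplaceKernel κ c‖ₑ * ∫⁻ α, M α * ‖laplaceKernel κ α‖ₑ := by
  have shift : ∀ α, M (α - c) * ‖laplaceKernel κ α‖ₑ =
      ‖laplaceKernel κ c‖ₑ * (M (α - c) * ‖laplaceKernel κ (α - c)‖ₑ) := fun α => by
    rw [mul_left_comm, ← enorm_mul, ← laplaceKernel_add, add_sub_cancel]
  simp_rw [shift]
  rw [lintegral_const_mul' _ _ enorm_ne_top,
    lintegral_sub_right_eq_self fun α => M α * ‖laplaceKernel κ α‖ₑ]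

lemma measurable_laplace {B : ℝ → ℝ → ℂ} (hB : Measurable (Function.uncurry B)) (κ : ℂ) :
    Measurable fun x => laplace (fun α => B α x) κ := by
  have h : Measurable fun r : ℝ × ℝ => B r.2 r.1 * laplaceKernel κ r.2 :=
    (hB.comp measurable_swap).mul ((continuous_laplaceKernel κ).measurable.comp measurable_snd)
  exact (h.stronglyMeasurable.integral_prod_right' (ν := volume)).measurable

end LaplaceTransform

section AbsoluteContinuity

variable {E : Type*} [NormedAddCommGroup E] [NormedSpace ℝ E] {a b : ℝ}

lemma absolutelyContinuousOnInterval_primitive {f : ℝ → E} (hf : IntervalIntegrable f volume a b) :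
    AbsolutelyContinuousOnInterval (fun x => ∫ t in a..x, f t) a b := by
  have hnorm : AbsolutelyContinuousOnInterval (fun x => ∫ t in a..x, ‖f t‖) a b :=
    hf.norm.absolutelyContinuousOnInterval_intervalIntegral left_mem_uIcc
  refine squeeze_zero' (Eventually.of_forall fun I => Finset.sum_nonneg fun _ _ => dist_nonneg)
    (eventually_inf_principal.2 (Eventually.of_forall fun I hI => ?_)) hnorm
  refine Finset.sum_le_sum fun i hi => ?_
  have hsub : ∀ {x}, x ∈ uIcc a b → IntervalIntegrable f volume a x := fun hx =>
    hf.mono_set (uIcc_subset_uIcc_left hx)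
  obtain ⟨hl, hr⟩ := hI.1 i hi
  rw [dist_eq_norm, dist_eq_norm, intervalIntegral.integral_interval_sub_left (hsub hl) (hsub hr),
    intervalIntegral.integral_interval_sub_left (hsub hl).norm (hsub hr).norm]
  exact intervalIntegral.norm_integral_le_abs_integral_norm

variable {𝕜 : Type*} [NormedField 𝕜] [NormedAlgebra ℝ 𝕜] [CompleteSpace 𝕜]

lemma mul_eq_add_integral_of_eq_add_integral {F G f g : ℝ → 𝕜}
    (hf : IntervalIntegrable f volume a b) (hg : IntervalIntegrable g volume a b)
    (hF : ∀ x ∈ uIcc a b, F x = F a + ∫ t in a..x, f t)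
    (hG : ∀ x ∈ uIcc a b, G x = G a + ∫ t in a..x, g t) :
    F b * G b = F a * G a + ∫ t in a..b, (f t * G t + F t * g t) := by
  set P : ℝ → 𝕜 := fun x => F a + ∫ t in a..x, f t
  set R : ℝ → 𝕜 := fun x => G a + ∫ t in a..x, g t
  have hconst (c : 𝕜) : AbsolutelyContinuousOnInterval (fun _ : ℝ => c) a b :=
    contDiffOn_const.absolutelyContinuousOnInterval
  have hP : AbsolutelyContinuousOnInterval P a b :=
    (hconst _).add (absolutelyContinuousOnInterval_primitive hf)
  have hR : AbsolutelyContinuousOnInterval R a b :=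
    (hconst _).add (absolutelyContinuousOnInterval_primitive hg)
  have hd : IntervalIntegrable (fun t => f t * R t + P t * g t) volume a b :=
    (hf.mul_continuousOn hR.continuousOn).add (hg.continuousOn_mul hP.continuousOn)
  have hderiv : ∀ᵐ x, x ∈ uIcc a b →
      HasDerivAt (fun x => P x * R x - ∫ t in a..x, (f t * R t + P t * g t)) 0 x := by
    filter_upwards [hf.ae_hasDerivAt_integral, hg.ae_hasDerivAt_integral,
      hd.ae_hasDerivAt_integral] with x hfx hgx hdx hx
    exact ((((hfx hx a left_mem_uIcc).const_add (F a)).mul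
      ((hgx hx a left_mem_uIcc).const_add (G a))).sub
        (hdx hx a left_mem_uIcc)).congr_deriv (sub_self _)
  obtain ⟨C, hC⟩ := ((hP.smul hR).sub
    (absolutelyContinuousOnInterval_primitive hd)).const_of_ae_hasDerivAt_zero hderiv
  have hends := (hC b right_mem_uIcc).trans (hC a left_mem_uIcc).symm
  have hcongr : ∫ t in a..b, (f t * G t + F t * g t) = ∫ t in a..b, (f t * R t + P t * g t) :=
    intervalIntegral.integral_congr fun t ht => by simp only [P, R, hF t ht, hG t ht]
  rw [hcongr, hF b right_mem_uIcc, hG b right_mem_uIcc]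
  simpa [P, R, sub_eq_iff_eq_add, add_comm] using hends

end AbsoluteContinuity

namespace IsWeylSolution

variable {q : ℝ → ℝ} {z : ℂ} {u u' v v' : ℝ → ℂ}

lemma continuousOn (hu : IsWeylSolution q z u u') : ContinuousOn u (Ici 0) :=
  fun x hx => (hu.hasDeriv x hx).continuousWithinAt

lemma hasDerivAt (hu : IsWeylSolution q z u u') {x : ℝ} (hx : 0 < x) : HasDerivAt u (u' x) x :=
  (hu.hasDeriv x hx.le).hasDerivAt (Ici_mem_nhds hx)

lemma intervalIntegrable (hu : IsWeylSolution q z u u') (hq : LocallyIntegrableOn q (Ici 0))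
    {x : ℝ} (hx : 0 ≤ x) : IntervalIntegrable (fun t => ((q t : ℂ) - z) * u t) volume 0 x := by
  have hsub : uIcc 0 x ⊆ Ici 0 := fun y hy => (uIcc_of_le hx ▸ hy).1
  have hqx : IntervalIntegrable q volume 0 x :=
    (hq.integrableOn_compact_subset hsub isCompact_uIcc).intervalIntegrable
  have hqc : IntervalIntegrable (fun t => (q t : ℂ)) volume 0 x := ⟨hqx.1.ofReal, hqx.2.ofReal⟩
  exact (hqc.sub intervalIntegrable_const).mul_continuousOn (hu.continuousOn.mono hsub)

lemma continuousOn_deriv (hu : IsWeylSolution q z u u') (hq : LocallyIntegrableOn q (Ici 0))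
    {x : ℝ} (hx : 0 ≤ x) : ContinuousOn u' (uIcc 0 x) := by
  have hprim := intervalIntegral.continuousOn_primitive_interval' (hu.intervalIntegrable hq hx)
    left_mem_uIcc
  exact ((continuousOn_const (c := u' 0)).add hprim).congr fun s hs =>
    hu.equation s (uIcc_of_le hx ▸ hs).1

lemma eq_add_integral_deriv (hu : IsWeylSolution q z u u') (hq : LocallyIntegrableOn q (Ici 0))
    {x : ℝ} (hx : 0 ≤ x) : u x = u 0 + ∫ t in (0 : ℝ)..x, u' t := by
  rw [intervalIntegral.integral_eq_sub_of_hasDeriv_right_of_le hx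
    (hu.continuousOn.mono fun y hy => hy.1) (fun s hs => (hu.hasDerivAt hs.1).hasDerivWithinAt)
    (hu.continuousOn_deriv hq hx).intervalIntegrable, add_sub_cancel]

lemma wronskian_eq (hu : IsWeylSolution q z u u') (hv : IsWeylSolution q z v v')
    (hq : LocallyIntegrableOn q (Ici 0)) {x : ℝ} (hx : 0 ≤ x) :
    v' x * u x - u' x * v x = v' 0 * u 0 - u' 0 * v 0 := by
  have hnn : ∀ s ∈ uIcc 0 x, 0 ≤ s := fun s hs => (uIcc_of_le hx ▸ hs).1
  rw [mul_eq_add_integral_of_eq_add_integral (hv.intervalIntegrable hq hx)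
      (hu.continuousOn_deriv hq hx).intervalIntegrable (fun s hs => hv.equation s (hnn s hs))
      fun s hs => hu.eq_add_integral_deriv hq (hnn s hs),
    mul_eq_add_integral_of_eq_add_integral (hu.intervalIntegrable hq hx)
      (hv.continuousOn_deriv hq hx).intervalIntegrable (fun s hs => hu.equation s (hnn s hs))
      fun s hs => hv.eq_add_integral_deriv hq (hnn s hs)]
  have hsymm : ∫ s in (0 : ℝ)..x, (((q s : ℂ) - z) * v s * u s + v' s * u' s) =
      ∫ s in (0 : ℝ)..x, (((q s : ℂ) - z) * u s * v s + u' s * v' s) :=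
    intervalIntegral.integral_congr fun s _ => by ring
  rw [hsymm]
  ring

-- If the Wronskian `W` were nonzero, then `(u v)' = W + 2 u' v` with `u' v ∈ L¹` would make `u v`
-- grow linearly, although it is integrable.
lemma wronskian_eq_zero (hu : IsWeylSolution q z u u') (hv : IsWeylSolution q z v v')
    (hq : LocallyIntegrableOn q (Ici 0)) (hu' : MemLp u' 2 (volume.restrict (Ioi 0))) :
    v' 0 * u 0 - u' 0 * v 0 = 0 := by
  set W := v' 0 * u 0 - u' 0 * v 0
  by_contra hne
  have huv : IntegrableOn (fun x => u x * v x) (Ioi 0) := hu.memLp.integrable_mul hv.memLp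
  have hu'v : IntegrableOn (fun x => 2 * (u' x * v x)) (Ioi 0) :=
    (hu'.integrable_mul hv.memLp).const_mul 2
  have hderiv : ∀ x ∈ Ioi (0 : ℝ),
      HasDerivAt (fun x : ℝ => u x * v x - W * x) (2 * (u' x * v x)) x := by
    intro x hx
    have hlin : HasDerivAt (fun x : ℝ => W * (x : ℂ)) W x := by
      simpa using (Complex.ofRealCLM.hasDerivAt (x := x)).const_mul W
    refine (((hu.hasDerivAt hx).mul (hv.hasDerivAt hx)).sub hlin).congr_deriv ?_
    linear_combination hu.wronskian_eq hv hq (le_of_lt hx)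
  have hlim := tendsto_limUnder_of_hasDerivAt_of_integrableOn_Ioi hderiv hu'v
  have hlin : Tendsto (fun x : ℝ => ‖W * (x : ℂ)‖) atTop atTop := by
    simp_rw [norm_mul, Complex.norm_real]
    exact tendsto_norm_atTop_atTop.const_mul_atTop (norm_pos_iff.2 hne)
  have hgrow : Tendsto (fun x => ‖u x * v x‖) atTop atTop := by
    refine tendsto_atTop_mono (fun x => ?_) (hlin.atTop_add hlim.norm.neg)
    linarith [norm_sub_norm_le (W * (x : ℂ)) (W * x - u x * v x),
      norm_sub_rev (u x * v x) (W * x), congrArg norm (sub_sub_cancel (W * (x : ℂ)) (u x * v x))]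
  obtain ⟨R, hR⟩ := eventually_atTop.1 (hgrow.eventually_ge_atTop 1)
  have hsub : Ioi (max R 0) ⊆ {x | 1 ≤ ‖u x * v x‖} ∩ Ioi 0 := fun x hx =>
    ⟨hR x ((le_max_left _ _).trans (le_of_lt hx)), (le_max_right R 0).trans_lt (mem_Ioi.1 hx)⟩
  refine (huv.measure_norm_ge_lt_top one_pos).ne (eq_top_mono ?_ (Real.volume_Ioi (a := max R 0)))
  exact (measure_mono hsub).trans (Measure.le_restrict_apply _ _)

lemma div_eq_div_zero (hu : IsWeylSolution q z u u') (hv : IsWeylSolution q z v v')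
    (hq : LocallyIntegrableOn q (Ici 0)) (hu' : MemLp u' 2 (volume.restrict (Ioi 0)))
    (hne : ∀ x, 0 ≤ x → u x ≠ 0) {x : ℝ} (hx : 0 ≤ x) : v x / u x = v 0 / u 0 := by
  have hc : Icc 0 x ⊆ Ici 0 := fun y hy => hy.1
  refine constant_of_has_deriv_right_zero (f := fun x => v x / u x)
    ((hv.continuousOn.mono hc).div (hu.continuousOn.mono hc) fun s hs => hne s hs.1)
    (fun s hs => ?_) x ⟨hx, le_rfl⟩
  have hd := ((hv.hasDeriv s hs.1).div (hu.hasDeriv s hs.1) (hne s hs.1)).mono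
    (Ici_subset_Ici.2 hs.1)
  have hW := (hu.wronskian_eq hv hq hs.1).trans (hu.wronskian_eq_zero hv hq hu')
  exact hd.congr_deriv (div_eq_zero_iff.2 (Or.inl (by linear_combination hW)))

lemma apply_zero_ne_zero (hu : IsWeylSolution q z u u') (hv : IsWeylSolution q z v v')
    (hq : LocallyIntegrableOn q (Ici 0)) (hu' : MemLp u' 2 (volume.restrict (Ioi 0)))
    (hne : ∀ x, 0 ≤ x → u x ≠ 0) : v 0 ≠ 0 := by
  intro hv0
  obtain ⟨x, hx, hvx⟩ := hv.nonzero
  have h := hu.div_eq_div_zero hv hq hu' hne hx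
  rw [hv0, zero_div, div_eq_zero_iff] at h
  exact h.elim hvx (hne x hx)

lemma div_zero_eq_div_zero (hu : IsWeylSolution q z u u') (hv : IsWeylSolution q z v v')
    (hq : LocallyIntegrableOn q (Ici 0)) (hu' : MemLp u' 2 (volume.restrict (Ioi 0)))
    (hne : ∀ x, 0 ≤ x → u x ≠ 0) : v' 0 / v 0 = u' 0 / u 0 := by
  rw [div_eq_div_iff (hu.apply_zero_ne_zero hv hq hu' hne) (hne 0 le_rfl)]
  exact sub_eq_zero.1 (hu.wronskian_eq_zero hv hq hu')

lemma weylM_eq (hu : IsWeylSolution q z u u') (hq : LocallyIntegrableOn q (Ici 0))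
    (hu' : MemLp u' 2 (volume.restrict (Ioi 0))) (hne : ∀ x, 0 ≤ x → u x ≠ 0) :
    weylM q z = u' 0 / u 0 := by
  have hex : ∃ w : (ℝ → ℂ) × (ℝ → ℂ), IsWeylSolution q z w.1 w.2 := ⟨(u, u'), hu⟩
  rw [weylM, dif_pos hex]
  exact hu.div_zero_eq_div_zero hex.choose_spec hq hu' hne

lemma congr {p : ℝ → ℝ} (hu : IsWeylSolution q z u u') (hqp : q =ᵐ[volume.restrict (Ioi 0)] p) :
    IsWeylSolution p z u u' where
  hasDeriv := hu.hasDeriv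
  equation x hx := by
    rw [hu.equation x hx]
    congr 1
    refine intervalIntegral.integral_congr_ae ?_
    rw [uIoc_of_le hx]
    filter_upwards [(ae_restrict_iff' measurableSet_Ioi).1 hqp] with t ht hmem
    rw [ht hmem.1]
  nonzero := hu.nonzero
  memLp := hu.memLp

end IsWeylSolution

section LaplaceAnalytic

variable {κ : ℂ} {f : ℝ → ℂ}

lemma aestronglyMeasurable_of_mul_laplaceKernel
    (hf : AEStronglyMeasurable fun α => f α * laplaceKernel κ α) : AEStronglyMeasurable f := by
  refine (hf.mul ((continuous_laplaceKernel κ).comp continuous_neg).aestronglyMeasurable).congr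
    (ae_of_all _ fun α => ?_)
  have h := laplaceKernel_neg_mul_cancel κ α
  simp only [Pi.mul_apply, Function.comp_apply]
  linear_combination f α * h

lemma norm_laplaceKernel_le_add {w c₁ c₂ : ℂ} (h₁ : c₁.re ≤ w.re) (h₂ : w.re ≤ c₂.re) (α : ℝ) :
    ‖laplaceKernel w α‖ ≤ ‖laplaceKernel c₁ α‖ + ‖laplaceKernel c₂ α‖ := by
  simp only [norm_laplaceKernel]
  rcases le_total 0 α with h | h
  · exact le_add_of_le_of_nonneg (Real.exp_le_exp.2 (by nlinarith)) (Real.exp_nonneg _)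
  · exact le_add_of_nonneg_of_le (Real.exp_nonneg _) (Real.exp_le_exp.2 (by nlinarith))

lemma two_mul_abs_mul_norm_laplaceKernel_le {w c₁ c₂ : ℂ} {δ : ℝ} (hδ : 0 < δ)
    (h₁ : c₁.re + δ ≤ w.re) (h₂ : w.re + δ ≤ c₂.re) (α : ℝ) :
    2 * |α| * ‖laplaceKernel w α‖ ≤ (‖laplaceKernel c₁ α‖ + ‖laplaceKernel c₂ α‖) * δ⁻¹ := by
  have hexp : 2 * |α| * δ ≤ Real.exp (2 * |α| * δ) := by
    linarith [Real.add_one_le_exp (2 * |α| * δ)]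
  have hle : Real.exp (2 * |α| * δ) * ‖laplaceKernel w α‖ ≤
      ‖laplaceKernel c₁ α‖ + ‖laplaceKernel c₂ α‖ := by
    rcases le_total 0 α with h | h
    · refine le_trans (le_of_eq ?_) (norm_laplaceKernel_le_add (w := w - δ)
        (by rw [Complex.sub_re, Complex.ofReal_re]; linarith)
        (by rw [Complex.sub_re, Complex.ofReal_re]; linarith) α)
      rw [norm_laplaceKernel, norm_laplaceKernel, ← Real.exp_add, abs_of_nonneg h,
        Complex.sub_re, Complex.ofReal_re]
      ring_nf
    · refine le_trans (le_of_eq ?_) (norm_laplaceKernel_le_add (w := w + δ)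
        (by rw [Complex.add_re, Complex.ofReal_re]; linarith)
        (by rw [Complex.add_re, Complex.ofReal_re]; linarith) α)
      rw [norm_laplaceKernel, norm_laplaceKernel, ← Real.exp_add, abs_of_nonpos h,
        Complex.add_re, Complex.ofReal_re]
      ring_nf
  rw [le_mul_inv_iff₀ hδ, mul_right_comm]
  exact (mul_le_mul_of_nonneg_right hexp (norm_nonneg _)).trans hle

lemma differentiableAt_laplace {c₁ c₂ : ℂ} (hf₁ : Integrable fun α => f α * laplaceKernel c₁ α)
    (hf₂ : Integrable fun α => f α * laplaceKernel c₂ α) (h₁ : c₁.re < κ.re) (h₂ : κ.re < c₂.re) :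
    DifferentiableAt ℂ (laplace f) κ := by
  have hfm : AEStronglyMeasurable f := aestronglyMeasurable_of_mul_laplaceKernel hf₁.1
  obtain ⟨δ, hδ, hδ₁, hδ₂⟩ : ∃ δ > 0, c₁.re + δ ≤ κ.re - δ ∧ κ.re + δ + δ ≤ c₂.re :=
    ⟨min (κ.re - c₁.re) (c₂.re - κ.re) / 2, by simp [h₁, h₂],
      by linarith [min_le_left (κ.re - c₁.re) (c₂.re - κ.re)],
      by linarith [min_le_right (κ.re - c₁.re) (c₂.re - κ.re)]⟩
  have hbound : ∀ w ∈ Metric.ball κ δ, ∀ α, ‖f α * (-2 * (α : ℂ) * laplaceKernel w α)‖ ≤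
      (‖f α * laplaceKernel c₁ α‖ + ‖f α * laplaceKernel c₂ α‖) * δ⁻¹ := by
    intro w hw α
    have hre := abs_le.1 ((Complex.abs_re_le_norm (w - κ)).trans (mem_ball_iff_norm.1 hw).le)
    rw [Complex.sub_re] at hre
    have h := two_mul_abs_mul_norm_laplaceKernel_le hδ (by linarith [hre.1] : c₁.re + δ ≤ w.re)
      (by linarith [hre.2] : w.re + δ ≤ c₂.re) α
    simp only [norm_mul, norm_neg, Complex.norm_ofNat, Complex.norm_real, Real.norm_eq_abs]
    rw [← mul_add, mul_assoc ‖f α‖]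
    exact mul_le_mul_of_nonneg_left h (norm_nonneg _)
  have hF : ∀ w, AEStronglyMeasurable fun α => f α * laplaceKernel w α := fun w =>
    hfm.mul (continuous_laplaceKernel w).aestronglyMeasurable
  refine (hasDerivAt_integral_of_dominated_loc_of_deriv_le
    (F' := fun w α => f α * (-2 * (α : ℂ) * laplaceKernel w α)) (Metric.ball_mem_nhds κ hδ)
    (Eventually.of_forall hF) ?_ ?_ (ae_of_all _ fun α w hw => hbound w hw α)
    ((hf₁.norm.add hf₂.norm).mul_const _) (ae_of_all _ fun α w _ => ?_)).2.differentiableAt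
  · refine (hf₁.norm.add hf₂.norm).mono (hF κ) (ae_of_all _ fun α => ?_)
    rw [Pi.add_apply, Real.norm_of_nonneg (by positivity), norm_mul, norm_mul, norm_mul, ← mul_add]
    exact mul_le_mul_of_nonneg_left (norm_laplaceKernel_le_add h₁.le h₂.le α) (norm_nonneg _)
  · exact hfm.mul (by have := continuous_laplaceKernel κ; fun_prop)
  · have h := (((hasDerivAt_id w).const_mul (-2 * (α : ℂ))).cexp.const_mul (f α))
    exact h.congr_deriv (by simp [laplaceKernel, mul_comm, mul_left_comm])

lemma integrable_mul_laplaceKernel_of_re_le {c : ℂ} (hf0 : ∀ α < 0, f α = 0)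
    (hf : Integrable fun α => f α * laplaceKernel c α) (hκ : c.re ≤ κ.re) :
    Integrable fun α => f α * laplaceKernel κ α := by
  refine hf.mono ((aestronglyMeasurable_of_mul_laplaceKernel hf.1).mul
    (continuous_laplaceKernel κ).aestronglyMeasurable) (ae_of_all _ fun α => ?_)
  rcases lt_or_ge α 0 with h | h
  · simp [hf0 α h]
  · rw [norm_mul, norm_mul, norm_laplaceKernel, norm_laplaceKernel]
    gcongr ‖f α‖ * Real.exp ?_
    nlinarith

lemma differentiableAt_laplace_of_re_lt {c : ℂ} (hf0 : ∀ α < 0, f α = 0)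
    (hf : Integrable fun α => f α * laplaceKernel c α) (hκ : c.re < κ.re) :
    DifferentiableAt ℂ (laplace f) κ :=
  differentiableAt_laplace hf (c₂ := κ + 1)
    (integrable_mul_laplaceKernel_of_re_le hf0 hf
      (by rw [Complex.add_re, Complex.one_re]; linarith)) hκ
    (by simp)

lemma norm_laplace_le_of_eq_zero {a : ℝ} {c : ℂ} (hf0 : ∀ α ≤ a, f α = 0)
    (hf : Integrable fun α => f α * laplaceKernel c α) (hκ : c.re ≤ κ.re) :
    ‖laplace f κ‖ ≤ Real.exp (-2 * a * (κ.re - c.re)) * ∫ α, ‖f α * laplaceKernel c α‖ := by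
  rw [← integral_const_mul]
  refine norm_integral_le_of_norm_le (hf.norm.const_mul _) (ae_of_all _ fun α => ?_)
  rw [norm_mul, norm_mul, norm_laplaceKernel, norm_laplaceKernel]
  rcases le_or_gt α a with h | h
  · simp [hf0 α h]
  · rw [mul_left_comm, ← Real.exp_add]
    gcongr ‖f α‖ * Real.exp ?_
    nlinarith

lemma laplace_conj (f : ℝ → ℝ) (κ : ℂ) :
    laplace (fun α => f α) (starRingEnd ℂ κ) = starRingEnd ℂ (laplace (fun α => f α) κ) := by
  rw [laplace, laplace, ← integral_conj]
  congr 1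
  funext α
  simp [laplaceKernel, ← Complex.exp_conj, map_ofNat]

lemma fourier_eq_laplace (f : ℝ → ℂ) (t : ℝ) :
    FourierTransform.fourier f t = laplace f (Real.pi * t * Complex.I) := by
  rw [Real.fourier_eq', laplace]
  congr 1
  funext α
  rw [smul_eq_mul, mul_comm, laplaceKernel]
  congr 2
  simp only [RCLike.inner_apply, conj_trivial]
  push_cast
  ring

end LaplaceAnalytic

section Uniqueness

open scoped FourierTransform

lemma ae_eq_zero_of_fourier_eq_zero {V E : Type*} [NormedAddCommGroup V] [InnerProductSpace ℝ V]
    [FiniteDimensional ℝ V] [MeasurableSpace V] [BorelSpace V] [NormedAddCommGroup E]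
    [NormedSpace ℂ E] [CompleteSpace E] {f : V → E} (hf : Integrable f) (h : 𝓕 f = 0) :
    f =ᵐ[volume] 0 := by
  refine ae_eq_zero_of_integral_contDiff_smul_eq_zero hf.locallyIntegrable fun g hg hgc => ?_
  let φ : SchwartzMap V ℂ := HasCompactSupport.toSchwartzMap (f := fun x => (g x : ℂ))
    (hgc.comp_left (g := Complex.ofReal) rfl) (Complex.ofRealCLM.contDiff.comp hg)
  have hφ : ∀ x, φ x = g x := fun _ => rfl
  let ψ : SchwartzMap V ℂ := 𝓕⁻ φ
  have hψ : 𝓕 (ψ : V → ℂ) = φ := by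
    rw [← SchwartzMap.fourier_coe, FourierTransform.fourier_fourierInv_eq]
  calc ∫ x, g x • f x = ∫ x, 𝓕 (ψ : V → ℂ) x • f x := by simp only [hψ, hφ, Complex.coe_smul]
    _ = ∫ x, ψ x • 𝓕 f x := by
      simpa using! VectorFourier.integral_fourierIntegral_smul_eq_flip (L := innerₗ V)
        Real.continuous_fourierChar continuous_inner ψ.integrable hf
    _ = 0 := by simp [h]

-- The half-plane `|arg(z e^{-iπ/4})| ≤ π/2` is bounded by one of the given rays and by a ray in the
-- left half-plane.
lemma norm_le_of_bounded_on_ray {G : ℂ → ℂ} (hG : Differentiable ℂ G) {K B C : ℝ}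
    (hexp : ∀ z, ‖G z‖ ≤ K * Real.exp (B * ‖z‖))
    (hconj : ∀ z, ‖G (starRingEnd ℂ z)‖ = ‖G z‖) (hleft : ∀ z : ℂ, z.re ≤ 0 → ‖G z‖ ≤ C)
    (hray : ∀ r : ℝ, 0 ≤ r → ‖G (r * (1 - Complex.I))‖ ≤ C) (z : ℂ) : ‖G z‖ ≤ C := by
  have hupper : ∀ z : ℂ, 0 ≤ z.re → 0 ≤ z.im → ‖G z‖ ≤ C := by
    intro z hre him
    have hω : (1 + Complex.I : ℂ) ≠ 0 := fun h => by simpa using congrArg Complex.re h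
    rw [← div_mul_cancel₀ z hω]
    refine PhragmenLindelof.right_half_plane_of_bounded_on_real
      (f := fun w => G (w * (1 + Complex.I))) (by fun_prop : Differentiable ℂ _).diffContOnCl
      ⟨1, one_lt_two, B * ‖1 + Complex.I‖, Asymptotics.IsBigO.of_bound K
        (Eventually.of_forall fun w => ?_)⟩ ⟨C, eventually_map.2 ?_⟩ (fun x => ?_) ?_
    · rw [Real.norm_of_nonneg (Real.exp_nonneg _), Real.rpow_one, mul_assoc, mul_comm ‖1 + _‖,
        ← norm_mul]
      exact hexp _
    · filter_upwards [eventually_ge_atTop 0] with r hr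
      simpa [← sub_eq_add_neg] using (hconj (r * (1 - Complex.I))).trans_le (hray r hr)
    · rcases le_total 0 x with hx | hx
      · exact hleft _ (by simpa)
      · have h := hray (-x) (neg_nonneg.2 hx)
        rwa [show ((-x : ℝ) : ℂ) * (1 - Complex.I) = x * Complex.I * (1 + Complex.I) by
          push_cast; linear_combination -x * Complex.I_mul_I] at h
    · simp only [Complex.div_re, Complex.add_re, Complex.one_re, Complex.I_re, add_zero, mul_one,
        Complex.add_im, Complex.one_im, Complex.I_im, zero_add]
      have := Complex.normSq_nonneg (1 + Complex.I)
      positivity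
  rcases le_total z.re 0 with hre | hre
  · exact hleft z hre
  rcases le_total 0 z.im with him | him
  · exact hupper z hre him
  · rw [← hconj]
    exact hupper _ (by simpa) (by simpa)

variable {g : ℝ → ℝ} {b : ℝ}

lemma integrable_mul_laplaceKernel_of_eq_zero (hg : Integrable g) (hgb : ∀ α ∉ Ioc (-b) 0, g α = 0)
    (κ : ℂ) : Integrable fun α => (g α : ℂ) * laplaceKernel κ α := by
  have h : IntegrableOn (fun α => (g α : ℂ) * laplaceKernel κ α) (Icc (-b) 0) :=
    hg.ofReal.integrableOn.mul_continuousOn (continuous_laplaceKernel κ).continuousOn isCompact_Icc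
  refine (integrableOn_iff_integrable_of_support_subset fun α hα => ?_).1 h
  by_contra hmem
  exact hα (by simp [hgb α fun h' => hmem (Ioc_subset_Icc_self h')])

lemma differentiable_laplace_of_eq_zero (hg : Integrable g) (hgb : ∀ α ∉ Ioc (-b) 0, g α = 0) :
    Differentiable ℂ (laplace fun α => g α) := fun κ =>
  differentiableAt_laplace (integrable_mul_laplaceKernel_of_eq_zero hg hgb (κ - 1))
    (integrable_mul_laplaceKernel_of_eq_zero hg hgb (κ + 1)) (by simp) (by simp)

lemma norm_laplace_le_integral_norm_mul_exp (hg : Integrable g) (hgb : ∀ α ∉ Ioc (-b) 0, g α = 0)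
    {κ : ℂ} {D : ℝ} (hD : 0 ≤ D) (hκ : κ.re ≤ D) :
    ‖laplace (fun α => g α) κ‖ ≤ (∫ α, ‖g α‖) * Real.exp (2 * b * D) := by
  rw [← integral_mul_const]
  refine norm_integral_le_of_norm_le (hg.norm.mul_const _) (ae_of_all _ fun α => ?_)
  by_cases hα : α ∈ Ioc (-b) 0
  · rw [norm_mul, Complex.norm_real, norm_laplaceKernel]
    refine mul_le_mul_of_nonneg_left (Real.exp_le_exp.2 ?_) (norm_nonneg _)
    nlinarith [mul_nonneg (neg_nonneg.2 hα.2) (sub_nonneg.2 hκ),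
      mul_nonneg (neg_le_iff_add_nonneg'.1 hα.1.le) hD]
  · simp [hgb α hα]

-- On the right half-plane, boundedness comes from the ray by Phragmén-Lindelöf; on the left one it
-- is trivial. So the transform is constant, and the constant is `0` by Riemann-Lebesgue.
lemma laplace_eq_zero_of_bounded_on_ray (hg : Integrable g) (hgb : ∀ α ∉ Ioc (-b) 0, g α = 0)
    {C : ℝ} (hC : ∀ r : ℝ, 0 ≤ r → ‖laplace (fun α => g α) (r * (1 - Complex.I))‖ ≤ C) (κ : ℂ) :
    laplace (fun α => g α) κ = 0 := by
  set G : ℂ → ℂ := laplace fun α => g α with hG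
  have hGd : Differentiable ℂ G := differentiable_laplace_of_eq_zero hg hgb
  have hbdd : ∀ z, ‖G z‖ ≤ max C (∫ α, ‖g α‖) := by
    refine norm_le_of_bounded_on_ray hGd (fun z => norm_laplace_le_integral_norm_mul_exp hg hgb
      (norm_nonneg z) (Complex.re_le_norm z)) (fun z => ?_) (fun z hz => ?_)
      fun r hr => (hC r hr).trans (le_max_left _ _)
    · rw [hG, laplace_conj, Complex.norm_conj]
    · refine le_trans ?_ (le_max_right _ _)
      simpa using norm_laplace_le_integral_norm_mul_exp hg hgb le_rfl hz
  have hconst : ∀ z, G z = G κ := fun z => hGd.apply_eq_apply_of_bounded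
    (isBounded_iff_forall_norm_le.2 ⟨_, forall_mem_range.2 hbdd⟩) z κ
  have hlim := Real.zero_at_infty_fourier fun α => (g α : ℂ)
  refine tendsto_nhds_unique (tendsto_const_nhds.congr fun t => ?_) hlim
  rw [fourier_eq_laplace, ← hG, hconst (_ * _)]

lemma ae_eq_zero_of_laplace_bounded_on_ray (hg : Integrable g) (hgb : ∀ α ∉ Ioc (-b) 0, g α = 0)
    {C r₀ : ℝ} (hC : ∀ r : ℝ, r₀ ≤ r → ‖laplace (fun α => g α) (r * (1 - Complex.I))‖ ≤ C) :
    g =ᵐ[volume] 0 := by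
  obtain ⟨C', hC'⟩ := (isCompact_Icc (a := 0) (b := r₀)).exists_bound_of_continuousOn
    (f := fun r : ℝ => laplace (fun α => g α) (r * (1 - Complex.I)))
    ((differentiable_laplace_of_eq_zero hg hgb).continuous.comp (by fun_prop)).continuousOn
  have hzero := laplace_eq_zero_of_bounded_on_ray hg hgb (C := max C C') fun r hr => by
    rcases le_total r₀ r with h | h
    · exact (hC r h).trans (le_max_left _ _)
    · exact (hC' r ⟨hr, h⟩).trans (le_max_right _ _)
  filter_upwards [ae_eq_zero_of_fourier_eq_zero (f := fun α => (g α : ℂ)) hg.ofReal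
    (funext fun t => (fourier_eq_laplace _ t).trans (hzero _))] with α hα
  exact Complex.ofReal_eq_zero.1 hα

end Uniqueness

section PicardIteration

/-- Lebesgue measure on the half-plane `(0, ∞) × ℝ`. -/
abbrev halfPlaneMeasure : Measure (ℝ × ℝ) := (volume.restrict (Ioi 0)).prod volume

/-- The quadratic term `∫₀^∞ (B(·, x + t) * B(·, x + t))(α - t) dt` of the integral equation for the
`x`-dependent amplitude. -/
def selfConv (B : ℝ → ℝ → ℝ) (α x : ℝ) : ℝ :=
  ∫ p, B p.2 (x + p.1) * B (α - p.1 - p.2) (x + p.1) ∂halfPlaneMeasure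

/-- One step of the Picard iteration for the equation
`∂A/∂x = ∂A/∂α + ∫₀^α A(β, x) A(α - β, x) dβ`, `A(0₊, x) = q(x)`, integrated along the
characteristics `x + α = const`. -/
def picardStep (q : ℝ → ℝ) (B : ℝ → ℝ → ℝ) (α x : ℝ) : ℝ :=
  (Ioi 0).indicator (fun t => q (x + t)) α - selfConv B α x

/-- The Picard iterates for the `x`-dependent `A`-amplitude `A(α, x)`. -/
def ampIter (q : ℝ → ℝ) : ℕ → ℝ → ℝ → ℝ
  | 0 => 0
  | k + 1 => picardStep q (ampIter q k)

/-- The counterpart of `selfConv` for `x`-independent majorants. -/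
def majSelfConv (M : ℝ → ℝ≥0∞) (α : ℝ) : ℝ≥0∞ :=
  ∫⁻ p, M p.2 * M (α - p.1 - p.2) ∂halfPlaneMeasure

/-- The majorants of the Picard iterates for potentials bounded by `Q`. -/
def majIter (Q : ℝ≥0∞) : ℕ → ℝ → ℝ≥0∞
  | 0 => 0
  | k + 1 => fun α => (Ioi 0).indicator (fun _ => Q) α + majSelfConv (majIter Q k) α

section Measurability

variable {B : ℝ → ℝ → ℝ} {M : ℝ → ℝ≥0∞}

lemma measurable_selfConv_integrand (hB : Measurable (Function.uncurry B)) :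
    Measurable fun r : (ℝ × ℝ) × (ℝ × ℝ) =>
      B r.2.2 (r.1.2 + r.2.1) * B (r.1.1 - r.2.1 - r.2.2) (r.1.2 + r.2.1) :=
  (hB.comp (by fun_prop : Measurable fun r : (ℝ × ℝ) × (ℝ × ℝ) => (r.2.2, r.1.2 + r.2.1))).mul
    (hB.comp (by fun_prop : Measurable fun r : (ℝ × ℝ) × (ℝ × ℝ) =>
      (r.1.1 - r.2.1 - r.2.2, r.1.2 + r.2.1)))

lemma measurable_selfConv (hB : Measurable (Function.uncurry B)) :
    Measurable (Function.uncurry (selfConv B)) :=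
  ((measurable_selfConv_integrand hB).stronglyMeasurable.integral_prod_right'
    (ν := halfPlaneMeasure)).measurable

lemma measurable_ampIter {q : ℝ → ℝ} (hq : Measurable q) (k : ℕ) :
    Measurable (Function.uncurry (ampIter q k)) := by
  induction k with
  | zero => exact measurable_const
  | succ k ih =>
    refine Measurable.sub ?_ (measurable_selfConv ih)
    exact Measurable.indicator (s := {r : ℝ × ℝ | 0 < r.1}) (f := fun r => q (r.2 + r.1))
      (by fun_prop) (measurableSet_lt measurable_const measurable_fst)

lemma measurable_majSelfConv (hM : Measurable M) : Measurable (majSelfConv M) :=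
  Measurable.lintegral_prod_right'
    (f := fun r : ℝ × (ℝ × ℝ) => M r.2.2 * M (r.1 - r.2.1 - r.2.2)) (by fun_prop)

lemma measurable_majIter (Q : ℝ≥0∞) (k : ℕ) : Measurable (majIter Q k) := by
  induction k with
  | zero => exact measurable_const
  | succ k ih =>
    exact (measurable_const.indicator measurableSet_Ioi).add (measurable_majSelfConv ih)

end Measurability

section Domination

variable {B B' : ℝ → ℝ → ℝ} {M M' : ℝ → ℝ≥0∞}

lemma enorm_selfConv_le (hBM : ∀ α x, ‖B α x‖ₑ ≤ M α) (α x : ℝ) :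
    ‖selfConv B α x‖ₑ ≤ majSelfConv M α := by
  refine (enorm_integral_le_lintegral_enorm _).trans (lintegral_mono fun p => ?_)
  rw [enorm_mul]
  exact mul_le_mul' (hBM _ _) (hBM _ _)

lemma integrable_selfConv_integrand (hB : Measurable (Function.uncurry B))
    (hBM : ∀ α x, ‖B α x‖ₑ ≤ M α) {α : ℝ} (hα : majSelfConv M α ≠ ⊤) (x : ℝ) :
    Integrable (fun p : ℝ × ℝ => B p.2 (x + p.1) * B (α - p.1 - p.2) (x + p.1))
      halfPlaneMeasure := by
  refine ⟨((measurable_selfConv_integrand hB).comp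
    (measurable_prodMk_left (x := (α, x)))).aestronglyMeasurable, ?_⟩
  refine (lintegral_mono fun p => ?_).trans_lt hα.lt_top
  rw [enorm_mul]
  exact mul_le_mul' (hBM _ _) (hBM _ _)

lemma enorm_mul_sub_mul_add_le {R : Type*} [NormedDivisionRing R] {a a' b b' : R}
    {s s' m m' : ℝ≥0∞} (hb : ‖b‖ₑ ≤ s) (ha' : ‖a'‖ₑ ≤ m') (h : ‖a - b‖ₑ + s ≤ m)
    (h' : ‖a' - b'‖ₑ + s' ≤ m') : ‖a * a' - b * b'‖ₑ + s * s' ≤ m * m' := by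
  have hsplit : a * a' - b * b' = (a - b) * a' + b * (a' - b') := by noncomm_ring
  calc ‖a * a' - b * b'‖ₑ + s * s'
      ≤ (‖a - b‖ₑ * ‖a'‖ₑ + ‖b‖ₑ * ‖a' - b'‖ₑ) + s * s' := by
        rw [hsplit, ← enorm_mul, ← enorm_mul]
        gcongr
        exact enorm_add_le _ _
    _ ≤ (‖a - b‖ₑ * m' + s * ‖a' - b'‖ₑ) + s * s' := by gcongr
    _ = ‖a - b‖ₑ * m' + s * (‖a' - b'‖ₑ + s') := by ring
    _ ≤ ‖a - b‖ₑ * m' + s * m' := by gcongr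
    _ = (‖a - b‖ₑ + s) * m' := by ring
    _ ≤ m * m' := by gcongr

lemma enorm_selfConv_sub_add_le (hB : Measurable (Function.uncurry B))
    (hB' : Measurable (Function.uncurry B')) (hM : Measurable M) (hBM : ∀ α x, ‖B α x‖ₑ ≤ M α)
    (h : ∀ α x, ‖B' α x - B α x‖ₑ + M α ≤ M' α) (α x : ℝ) :
    ‖selfConv B' α x - selfConv B α x‖ₑ + majSelfConv M α ≤ majSelfConv M' α := by
  have hBM' : ∀ α x, ‖B' α x‖ₑ ≤ M' α := fun α x => calc
    ‖B' α x‖ₑ ≤ ‖B' α x - B α x‖ₑ + ‖B α x‖ₑ := by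
      simpa using enorm_add_le (B' α x - B α x) (B α x)
    _ ≤ ‖B' α x - B α x‖ₑ + M α := by gcongr; exact hBM α x
    _ ≤ M' α := h α x
  rcases eq_or_ne (majSelfConv M' α) ⊤ with htop | hfin
  · exact htop ▸ le_top
  have hfin' : majSelfConv M α ≠ ⊤ := ne_top_of_le_ne_top hfin <|
    lintegral_mono fun p => mul_le_mul' (le_add_self.trans (h _ 0)) (le_add_self.trans (h _ 0))
  rw [selfConv, selfConv, ← integral_sub (integrable_selfConv_integrand hB' hBM' hfin x)
    (integrable_selfConv_integrand hB hBM hfin' x)]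
  refine (add_le_add_left (enorm_integral_le_lintegral_enorm _) _).trans ?_
  rw [majSelfConv, ← lintegral_add_right _
    (show Measurable fun p : ℝ × ℝ => M p.2 * M (α - p.1 - p.2) by fun_prop)]
  exact lintegral_mono fun p => enorm_mul_sub_mul_add_le (hBM _ _) (hBM' _ _) (h _ _) (h _ _)

variable {q : ℝ → ℝ} {Q : ℝ≥0∞}

lemma enorm_ampIter_le (hQ : ∀ x, ‖q x‖ₑ ≤ Q) (k : ℕ) :
    ∀ α x, ‖ampIter q k α x‖ₑ ≤ majIter Q k α := by
  induction k with
  | zero => simp [ampIter]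
  | succ k ih =>
    intro α x
    refine enorm_sub_le.trans (add_le_add ?_ (enorm_selfConv_le ih α x))
    rw [enorm_indicator_eq_indicator_enorm]
    exact indicator_le_indicator (hQ _)

lemma enorm_ampIter_sub_add_le (hq : Measurable q) (hQ : ∀ x, ‖q x‖ₑ ≤ Q) (k : ℕ) :
    ∀ α x, ‖ampIter q (k + 1) α x - ampIter q k α x‖ₑ + majIter Q k α ≤ majIter Q (k + 1) α := by
  induction k with
  | zero => exact fun α x => by simpa [ampIter, majIter] using enorm_ampIter_le hQ 1 α x
  | succ k ih =>
    intro α x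
    have h := enorm_selfConv_sub_add_le (measurable_ampIter hq k) (measurable_ampIter hq (k + 1))
      (measurable_majIter Q k) (enorm_ampIter_le hQ k) ih α x
    have hsub : ampIter q (k + 2) α x - ampIter q (k + 1) α x =
        -(selfConv (ampIter q (k + 1)) α x - selfConv (ampIter q k) α x) := by
      simp only [ampIter, picardStep]
      ring
    calc ‖ampIter q (k + 2) α x - ampIter q (k + 1) α x‖ₑ + majIter Q (k + 1) α
        = (Ioi 0).indicator (fun _ => (Q : ℝ≥0∞)) α +
            (‖selfConv (ampIter q (k + 1)) α x - selfConv (ampIter q k) α x‖ₑ +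
              majSelfConv (majIter Q k) α) := by
          rw [hsub, enorm_neg, majIter, add_left_comm]
      _ ≤ majIter Q (k + 2) α := add_le_add_right h _

lemma monotone_majIter (Q : ℝ≥0∞) : Monotone (majIter Q) :=
  monotone_nat_of_le_succ fun k α => le_add_self.trans
    (enorm_ampIter_sub_add_le (q := 0) measurable_const (by simp) k α 0)

lemma ampIter_of_nonpos (q : ℝ → ℝ) (k : ℕ) : ∀ α ≤ 0, ∀ x, ampIter q k α x = 0 := by
  induction k with
  | zero => exact fun _ _ _ => rfl
  | succ k ih =>
    intro α hα x
    have hconv : selfConv (ampIter q k) α x = 0 := by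
      refine integral_eq_zero_of_ae ?_
      have hpos : ∀ᵐ p : ℝ × ℝ ∂halfPlaneMeasure, 0 < p.1 :=
        Measure.quasiMeasurePreserving_fst.ae (ae_restrict_mem measurableSet_Ioi)
      filter_upwards [hpos] with p hp
      rcases le_total p.2 0 with h | h
      · simp [ih _ h]
      · simp [ih (α - p.1 - p.2) (by linarith)]
    rw [ampIter, picardStep, hconv, indicator_of_notMem (notMem_Ioi.2 hα), sub_zero]

end Domination

end PicardIteration

section LaplacePicard

section Majorant

/-- The smaller root `n = a - √(a² - Q)` of `2 a n = Q + n²`. It bounds the Laplace transforms at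
`a` of the majorants for potentials bounded by `Q`. -/
def majBound (Q a : ℝ) : ℝ := a - √(a ^ 2 - Q)

lemma majBound_eq {Q a : ℝ} (h : √Q < a) :
    (2 * a)⁻¹ * (Q + majBound Q a ^ 2) = majBound Q a := by
  have ha : 0 < a := (Real.sqrt_nonneg Q).trans_lt h
  have hsq : √(a ^ 2 - Q) ^ 2 = a ^ 2 - Q := Real.sq_sqrt (sub_pos.2 (Real.lt_sq_of_sqrt_lt h)).le
  rw [inv_mul_eq_iff_eq_mul₀ (by positivity), majBound]
  linear_combination hsq

lemma majBound_nonneg {Q a : ℝ} (hQ : 0 ≤ Q) (ha : 0 ≤ a) : 0 ≤ majBound Q a := by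
  rw [majBound, sub_nonneg, Real.sqrt_le_left ha]
  linarith

lemma majBound_lt {Q a : ℝ} (h : √Q < a) : majBound Q a < a :=
  sub_lt_self _ (Real.sqrt_pos.2 (sub_pos.2 (Real.lt_sq_of_sqrt_lt h)))

variable {Q : ℝ≥0} {κ : ℂ} {M : ℝ → ℝ≥0∞}

lemma lintegral_majSelfConv_mul_enorm_laplaceKernel (hM : Measurable M) (κ : ℂ) :
    ∫⁻ α, majSelfConv M α * ‖laplaceKernel κ α‖ₑ =
      (∫⁻ t in Ioi 0, ‖laplaceKernel κ t‖ₑ) * (∫⁻ α, M α * ‖laplaceKernel κ α‖ₑ) ^ 2 := by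
  have inner : ∀ p : ℝ × ℝ, ∫⁻ α, M p.2 * M (α - p.1 - p.2) * ‖laplaceKernel κ α‖ₑ =
      ‖laplaceKernel κ p.1‖ₑ * (M p.2 * ‖laplaceKernel κ p.2‖ₑ) *
        ∫⁻ α, M α * ‖laplaceKernel κ α‖ₑ := fun p => by
    simp_rw [sub_sub, mul_assoc]
    rw [lintegral_const_mul _ (by fun_prop), lintegral_comp_sub_mul_enorm_laplaceKernel,
      laplaceKernel_add, enorm_mul]
    ring
  calc ∫⁻ α, majSelfConv M α * ‖laplaceKernel κ α‖ₑ
      = ∫⁻ α, ∫⁻ p, M p.2 * M (α - p.1 - p.2) * ‖laplaceKernel κ α‖ₑ ∂halfPlaneMeasure :=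
        lintegral_congr fun α => (lintegral_mul_const _ (by fun_prop)).symm
    _ = ∫⁻ p, (∫⁻ α, M p.2 * M (α - p.1 - p.2) * ‖laplaceKernel κ α‖ₑ) ∂halfPlaneMeasure :=
        lintegral_lintegral_swap (by fun_prop)
    _ = (∫⁻ p, ‖laplaceKernel κ p.1‖ₑ * (M p.2 * ‖laplaceKernel κ p.2‖ₑ) ∂halfPlaneMeasure) *
          ∫⁻ α, M α * ‖laplaceKernel κ α‖ₑ := by
        simp_rw [inner]
        exact lintegral_mul_const _ (by fun_prop)
    _ = _ := by
        rw [lintegral_prod_mul (f := fun t => ‖laplaceKernel κ t‖ₑ)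
          (g := fun β => M β * ‖laplaceKernel κ β‖ₑ) (by fun_prop) (by fun_prop), mul_assoc, sq]

lemma lintegral_majIter_mul_enorm_laplaceKernel_le (hκ : √(Q : ℝ) < κ.re) (k : ℕ) :
    ∫⁻ α, majIter Q k α * ‖laplaceKernel κ α‖ₑ ≤ ENNReal.ofReal (majBound Q κ.re) := by
  have hre : 0 < κ.re := (Real.sqrt_nonneg _).trans_lt hκ
  induction k with
  | zero => simp [majIter]
  | succ k ih =>
    have linear : ∀ α, (Ioi 0).indicator (fun _ => (Q : ℝ≥0∞)) α * ‖laplaceKernel κ α‖ₑ =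
        (Ioi 0).indicator (fun t => Q * ‖laplaceKernel κ t‖ₑ) α := fun α =>
      (indicator_mul_left (Ioi (0 : ℝ)) (fun _ => (Q : ℝ≥0∞)) fun t => ‖laplaceKernel κ t‖ₑ).symm
    simp_rw [majIter, add_mul, linear]
    rw [lintegral_add_left ((by fun_prop : Measurable fun t =>
        (Q : ℝ≥0∞) * ‖laplaceKernel κ t‖ₑ).indicator measurableSet_Ioi),
      lintegral_indicator measurableSet_Ioi, lintegral_const_mul' _ _ ENNReal.coe_ne_top,
      lintegral_majSelfConv_mul_enorm_laplaceKernel (measurable_majIter _ k),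
      lintegral_enorm_laplaceKernel hre]
    calc _ ≤ Q * ENNReal.ofReal (2 * κ.re)⁻¹ +
          ENNReal.ofReal (2 * κ.re)⁻¹ * ENNReal.ofReal (majBound Q κ.re) ^ 2 := by gcongr
      _ = ENNReal.ofReal ((2 * κ.re)⁻¹ * (Q + majBound Q κ.re ^ 2)) := by
          rw [ENNReal.ofReal_mul (by positivity),
            ENNReal.ofReal_add NNReal.zero_le_coe (sq_nonneg _),
            ENNReal.ofReal_pow (majBound_nonneg NNReal.zero_le_coe hre.le),
            ENNReal.ofReal_coe_nnreal]
          ring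
      _ = ENNReal.ofReal (majBound Q κ.re) := by rw [majBound_eq hκ]

/-- The limit of the increasing sequence of majorants. -/
def majSup (Q : ℝ≥0∞) (α : ℝ) : ℝ≥0∞ := ⨆ k, majIter Q k α

lemma majIter_le_majSup (Q : ℝ≥0∞) (k : ℕ) (α : ℝ) : majIter Q k α ≤ majSup Q α :=
  le_iSup (fun k => majIter Q k α) k

lemma measurable_majSup (Q : ℝ≥0∞) : Measurable (majSup Q) :=
  Measurable.iSup fun k => measurable_majIter Q k

lemma lintegral_majSup_mul_enorm_laplaceKernel_le (hκ : √(Q : ℝ) < κ.re) :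
    ∫⁻ α, majSup Q α * ‖laplaceKernel κ α‖ₑ ≤ ENNReal.ofReal (majBound Q κ.re) := by
  simp_rw [majSup, ENNReal.iSup_mul]
  rw [lintegral_iSup (f := fun k α => majIter Q k α * ‖laplaceKernel κ α‖ₑ)
    (fun k => (measurable_majIter _ k).mul (measurable_laplaceKernel κ).enorm)
    fun i j hij α => mul_le_mul_left (monotone_majIter _ hij α) _]
  exact iSup_le (lintegral_majIter_mul_enorm_laplaceKernel_le hκ)

lemma lintegral_majSup_mul_enorm_laplaceKernel_ne_top (hκ : √(Q : ℝ) < κ.re) :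
    ∫⁻ α, majSup Q α * ‖laplaceKernel κ α‖ₑ ≠ ⊤ :=
  ne_top_of_le_ne_top ENNReal.ofReal_ne_top (lintegral_majSup_mul_enorm_laplaceKernel_le hκ)

lemma ae_majSup_ne_top (Q : ℝ≥0) : ∀ᵐ α, majSup Q α ≠ ⊤ := by
  obtain ⟨a, ha⟩ := exists_gt √(Q : ℝ)
  have hfin := ae_lt_top ((measurable_majSup Q).mul (measurable_laplaceKernel a).enorm)
    (lintegral_majSup_mul_enorm_laplaceKernel_ne_top (κ := a) ha)
  filter_upwards [hfin] with α hα htop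
  simp [htop, ENNReal.top_mul (enorm_laplaceKernel_ne_zero _ α)] at hα

lemma norm_laplace_le_majBound {f : ℝ → ℂ} (hf : ∀ᵐ α, ‖f α‖ₑ ≤ majSup Q α)
    (hκ : √(Q : ℝ) < κ.re) : ‖laplace f κ‖ ≤ majBound Q κ.re := by
  rw [← toReal_enorm]
  exact ENNReal.toReal_le_of_le_ofReal
    (majBound_nonneg NNReal.zero_le_coe ((Real.sqrt_nonneg _).trans_lt hκ).le)
    ((enorm_laplace_le hf).trans (lintegral_majSup_mul_enorm_laplaceKernel_le hκ))

end Majorant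

section PicardStep

variable {B : ℝ → ℝ → ℝ} {M : ℝ → ℝ≥0∞} {κ : ℂ}

lemma integrable_selfConv_mul_laplaceKernel_integrand (hB : Measurable (Function.uncurry B))
    (hM : Measurable M) (hBM : ∀ α x, ‖B α x‖ₑ ≤ M α) (hκ : 0 < κ.re)
    (hfin : ∫⁻ α, M α * ‖laplaceKernel κ α‖ₑ ≠ ⊤) (x : ℝ) :
    Integrable (Function.uncurry fun (α : ℝ) (p : ℝ × ℝ) =>
      ((B p.2 (x + p.1) * B (α - p.1 - p.2) (x + p.1) : ℝ) : ℂ) * laplaceKernel κ α)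
      (volume.prod halfPlaneMeasure) := by
  have hmeas : Measurable fun r : ℝ × (ℝ × ℝ) =>
      B r.2.2 (x + r.2.1) * B (r.1 - r.2.1 - r.2.2) (x + r.2.1) :=
    (measurable_selfConv_integrand hB).comp
      (by fun_prop : Measurable fun r : ℝ × (ℝ × ℝ) => ((r.1, x), r.2))
  refine ⟨((Complex.measurable_ofReal.comp hmeas).mul
    ((measurable_laplaceKernel κ).comp measurable_fst)).aestronglyMeasurable, ?_⟩
  have hle : ∀ r : ℝ × (ℝ × ℝ),
      ‖((B r.2.2 (x + r.2.1) * B (r.1 - r.2.1 - r.2.2) (x + r.2.1) : ℝ) : ℂ) *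
        laplaceKernel κ r.1‖ₑ ≤ M r.2.2 * M (r.1 - r.2.1 - r.2.2) * ‖laplaceKernel κ r.1‖ₑ :=
    fun r => by
      rw [enorm_mul, enorm_complex_ofReal, enorm_mul]
      gcongr <;> exact hBM _ _
  refine (lintegral_mono hle).trans_lt ?_
  rw [lintegral_prod _ (by fun_prop)]
  calc _ = ∫⁻ α, majSelfConv M α * ‖laplaceKernel κ α‖ₑ :=
        lintegral_congr fun α => lintegral_mul_const _ (by fun_prop)
    _ < ⊤ := by
        rw [lintegral_majSelfConv_mul_enorm_laplaceKernel hM, lintegral_enorm_laplaceKernel hκ]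
        exact ENNReal.mul_lt_top ENNReal.ofReal_lt_top (ENNReal.pow_lt_top hfin.lt_top)

lemma laplace_selfConv (hB : Measurable (Function.uncurry B)) (hM : Measurable M)
    (hBM : ∀ α x, ‖B α x‖ₑ ≤ M α) (hκ : 0 < κ.re)
    (hfin : ∫⁻ α, M α * ‖laplaceKernel κ α‖ₑ ≠ ⊤) (x : ℝ) :
    laplace (fun α => (selfConv B α x : ℂ)) κ =
      ∫ t in Ioi 0, laplaceKernel κ t * laplace (fun α => (B α (x + t) : ℂ)) κ ^ 2 := by
  have hint := integrable_selfConv_mul_laplaceKernel_integrand hB hM hBM hκ hfin x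
  have inner : ∀ p : ℝ × ℝ,
      ∫ α, ((B p.2 (x + p.1) * B (α - p.1 - p.2) (x + p.1) : ℝ) : ℂ) * laplaceKernel κ α =
        laplaceKernel κ p.1 * laplace (fun α => (B α (x + p.1) : ℂ)) κ *
          ((B p.2 (x + p.1) : ℂ) * laplaceKernel κ p.2) := fun p => by
    have shift := laplace_comp_sub_right (fun α => (B α (x + p.1) : ℂ)) κ (p.1 + p.2)
    simp_rw [Complex.ofReal_mul, sub_sub, mul_assoc]
    rw [integral_const_mul, ← laplace, shift, laplaceKernel_add]
    ring
  have hint' := hint.integral_prod_right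
  simp_rw [Function.uncurry, inner] at hint'
  calc laplace (fun α => (selfConv B α x : ℂ)) κ
      = ∫ α, ∫ p, ((B p.2 (x + p.1) * B (α - p.1 - p.2) (x + p.1) : ℝ) : ℂ) * laplaceKernel κ α
          ∂halfPlaneMeasure := by
        simp_rw [laplace, selfConv, ← integral_complex_ofReal, ← integral_mul_const]
    _ = ∫ p, laplaceKernel κ p.1 * laplace (fun α => (B α (x + p.1) : ℂ)) κ *
          ((B p.2 (x + p.1) : ℂ) * laplaceKernel κ p.2) ∂halfPlaneMeasure := by
        rw [integral_integral_swap hint]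
        simp_rw [inner]
    _ = ∫ t in Ioi 0, laplaceKernel κ t * laplace (fun α => (B α (x + t) : ℂ)) κ ^ 2 := by
        rw [integral_prod _ hint']
        simp_rw [integral_const_mul, laplace, sq, mul_assoc]

lemma laplace_picardStep {q : ℝ → ℝ} (hq : Measurable q) {Q : ℝ≥0} (hQ : ∀ x, ‖q x‖ₑ ≤ Q)
    (hB : Measurable (Function.uncurry B)) (hM : Measurable M) (hBM : ∀ α x, ‖B α x‖ₑ ≤ M α)
    (hκ : 0 < κ.re) (hfin : ∫⁻ α, M α * ‖laplaceKernel κ α‖ₑ ≠ ⊤) (x : ℝ) :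
    laplace (fun α => (picardStep q B α x : ℂ)) κ =
      ∫ t in Ioi 0, laplaceKernel κ t *
        (q (x + t) - laplace (fun α => (B α (x + t) : ℂ)) κ ^ 2) := by
  have hlin : IntegrableOn (fun t => laplaceKernel κ t * (q (x + t) : ℂ)) (Ioi 0) :=
    integrableOn_laplaceKernel_mul hκ (by fun_prop)
      (fun t => norm_complex_ofReal_le_of_enorm_le (hQ (x + t))) 0
  have hquad : IntegrableOn
      (fun t => laplaceKernel κ t * laplace (fun α => (B α (x + t) : ℂ)) κ ^ 2) (Ioi 0) := by
    have hn : Measurable fun y => laplace (fun α => (B α y : ℂ)) κ :=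
      measurable_laplace (B := fun α y => (B α y : ℂ)) (Complex.measurable_ofReal.comp hB) κ
    refine integrableOn_laplaceKernel_mul hκ ((hn.comp (measurable_const_add x)).pow_const 2)
      (C := (∫⁻ α, M α * ‖laplaceKernel κ α‖ₑ).toReal ^ 2) (fun t => ?_) 0
    rw [norm_pow, ← toReal_enorm]
    gcongr
    refine enorm_laplace_le (ae_of_all _ fun α => ?_)
    rw [enorm_complex_ofReal]
    exact hBM _ _
  have hconv : Integrable fun α => (selfConv B α x : ℂ) * laplaceKernel κ α := by
    simp_rw [selfConv, ← integral_complex_ofReal, ← integral_mul_const]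
    exact (integrable_selfConv_mul_laplaceKernel_integrand hB hM hBM hκ hfin x).integral_prod_left
  have linear : ∀ α, (((Ioi 0).indicator (fun t => q (x + t)) α : ℝ) : ℂ) * laplaceKernel κ α =
      (Ioi 0).indicator (fun t => laplaceKernel κ t * (q (x + t) : ℂ)) α := fun α => by
    by_cases h : α ∈ Ioi (0 : ℝ) <;> simp [h, mul_comm]
  calc laplace (fun α => (picardStep q B α x : ℂ)) κ
      = ∫ α, ((Ioi 0).indicator (fun t => laplaceKernel κ t * (q (x + t) : ℂ)) α -
          (selfConv B α x : ℂ) * laplaceKernel κ α) := by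
        simp_rw [laplace, picardStep, Complex.ofReal_sub, sub_mul, linear]
    _ = (∫ t in Ioi 0, laplaceKernel κ t * (q (x + t) : ℂ)) -
          laplace (fun α => (selfConv B α x : ℂ)) κ := by
        rw [integral_sub (hlin.integrable_indicator measurableSet_Ioi) hconv,
          integral_indicator measurableSet_Ioi, laplace]
    _ = _ := by
        rw [laplace_selfConv hB hM hBM hκ hfin, ← integral_sub hlin hquad]
        simp_rw [mul_sub]

end PicardStep

end LaplacePicard

section Amplitude

/-- The `x`-dependent `A`-amplitude, the limit of the Picard iterates. (Where they diverge, on a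
null set of `α`, `limUnder` is a junk value.) -/
def amp (q : ℝ → ℝ) (α x : ℝ) : ℝ := limUnder atTop fun k => ampIter q k α x

lemma amp_of_nonpos (q : ℝ → ℝ) {α : ℝ} (hα : α ≤ 0) (x : ℝ) : amp q α x = 0 := by
  simp_rw [amp, ampIter_of_nonpos q _ α hα x]
  exact tendsto_const_nhds.limUnder_eq

variable {q : ℝ → ℝ} {Q : ℝ≥0}

lemma measurable_amp (hq : Measurable q) : Measurable (Function.uncurry (amp q)) :=
  (StronglyMeasurable.limUnder fun k => (measurable_ampIter hq k).stronglyMeasurable).measurable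

lemma enorm_ampIter_le_majSup (hQ : ∀ x, ‖q x‖ₑ ≤ Q) (k : ℕ) (α x : ℝ) :
    ‖ampIter q k α x‖ₑ ≤ majSup Q α :=
  (enorm_ampIter_le hQ k α x).trans (majIter_le_majSup Q k α)

lemma tendsto_ampIter (hq : Measurable q) (hQ : ∀ x, ‖q x‖ₑ ≤ Q) {α : ℝ} (hα : majSup Q α ≠ ⊤)
    (x : ℝ) : Tendsto (fun k => ampIter q k α x) atTop (𝓝 (amp q α x)) := by
  set d : ℕ → ℝ≥0∞ := fun k => ‖ampIter q (k + 1) α x - ampIter q k α x‖ₑ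
  have telescope : ∀ k, ∑ j ∈ Finset.range k, d j ≤ majIter Q k α := fun k => by
    induction k with
    | zero => simp
    | succ k ih =>
      rw [Finset.sum_range_succ_comm]
      exact (add_le_add le_rfl ih).trans (enorm_ampIter_sub_add_le hq hQ k α x)
  have hsum : ∑' k, d k ≠ ⊤ := by
    refine ne_top_of_le_ne_top hα ?_
    rw [ENNReal.tsum_eq_iSup_nat]
    exact iSup_mono telescope
  refine (cauchySeq_of_edist_le_of_tsum_ne_top d (fun k => ?_) hsum).tendsto_limUnder
  rw [edist_comm, edist_eq_enorm_sub]

lemma ae_enorm_amp_le (hq : Measurable q) (hQ : ∀ x, ‖q x‖ₑ ≤ Q) (x : ℝ) :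
    ∀ᵐ α, ‖amp q α x‖ₑ ≤ majSup Q α := by
  filter_upwards [ae_majSup_ne_top Q] with α hα
  exact le_of_tendsto (tendsto_ampIter hq hQ hα x).enorm
    (Eventually.of_forall fun k => enorm_ampIter_le_majSup hQ k α x)

lemma integrable_amp_mul_laplaceKernel (hq : Measurable q) (hQ : ∀ x, ‖q x‖ₑ ≤ Q) {κ : ℂ}
    (hκ : √(Q : ℝ) < κ.re) (x : ℝ) : Integrable fun α => (amp q α x : ℂ) * laplaceKernel κ α :=
  integrable_mul_laplaceKernel
    (Complex.measurable_ofReal.comp ((measurable_amp hq).comp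
      (measurable_prodMk_right (y := x)))).aestronglyMeasurable
    (by simpa only [enorm_complex_ofReal] using ae_enorm_amp_le hq hQ x)
    (lintegral_majSup_mul_enorm_laplaceKernel_ne_top hκ)

end Amplitude

section Riccati

/-- The Laplace transform in `α` of the `x`-dependent `A`-amplitude. -/
def riccati (q : ℝ → ℝ) (κ : ℂ) (x : ℝ) : ℂ := laplace (fun α => (amp q α x : ℂ)) κ

variable {q : ℝ → ℝ} {Q : ℝ≥0} {κ : ℂ}

lemma measurable_riccati (hq : Measurable q) (κ : ℂ) : Measurable (riccati q κ) :=
  measurable_laplace (B := fun α x => (amp q α x : ℂ))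
    (Complex.measurable_ofReal.comp (measurable_amp hq)) κ

lemma norm_riccati_le (hq : Measurable q) (hQ : ∀ x, ‖q x‖ₑ ≤ Q) (hκ : √(Q : ℝ) < κ.re) (x : ℝ) :
    ‖riccati q κ x‖ ≤ majBound Q κ.re :=
  norm_laplace_le_majBound (by simpa only [enorm_complex_ofReal] using ae_enorm_amp_le hq hQ x) hκ

lemma norm_sub_sq_le_of_norm_le {r : ℝ} {z : ℂ} {b : ℝ} (hr : ‖r‖ₑ ≤ Q) (hz : ‖z‖ ≤ b) :
    ‖(r : ℂ) - z ^ 2‖ ≤ Q + b ^ 2 := by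
  refine (norm_sub_le _ _).trans (add_le_add (norm_complex_ofReal_le_of_enorm_le hr) ?_)
  rw [norm_pow]
  gcongr

lemma tendsto_laplace_ampIter (hq : Measurable q) (hQ : ∀ x, ‖q x‖ₑ ≤ Q) (hκ : √(Q : ℝ) < κ.re)
    (x : ℝ) : Tendsto (fun k => laplace (fun α => (ampIter q k α x : ℂ)) κ) atTop
      (𝓝 (riccati q κ x)) := by
  refine tendsto_integral_of_dominated_convergence
    (fun α => (majSup Q α * ‖laplaceKernel κ α‖ₑ).toReal) (fun k => ?_) ?_ (fun k => ?_) ?_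
  · have hmeas : Measurable fun α => ampIter q k α x :=
      (measurable_ampIter hq k).comp (measurable_prodMk_right (y := x))
    exact Measurable.aestronglyMeasurable (by fun_prop)
  · exact integrable_toReal_of_lintegral_ne_top
      ((measurable_majSup _).mul (measurable_laplaceKernel κ).enorm).aemeasurable
      (lintegral_majSup_mul_enorm_laplaceKernel_ne_top hκ)
  · filter_upwards [ae_majSup_ne_top Q] with α hα
    rw [← toReal_enorm, enorm_mul, enorm_complex_ofReal]
    refine ENNReal.toReal_mono (ENNReal.mul_ne_top hα enorm_ne_top) ?_
    gcongr
    exact enorm_ampIter_le_majSup hQ k α x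
  · filter_upwards [ae_majSup_ne_top Q] with α hα
    exact ((Complex.continuous_ofReal.tendsto _).comp (tendsto_ampIter hq hQ hα x)).mul_const _

lemma riccati_eq_integral_Ioi (hq : Measurable q) (hQ : ∀ x, ‖q x‖ₑ ≤ Q) (hκ : √(Q : ℝ) < κ.re)
    (x : ℝ) : riccati q κ x =
      ∫ t in Ioi 0, laplaceKernel κ t * (q (x + t) - riccati q κ (x + t) ^ 2) := by
  have hre : 0 < κ.re := (Real.sqrt_nonneg _).trans_lt hκ
  refine tendsto_nhds_unique
    ((tendsto_laplace_ampIter hq hQ hκ x).comp (tendsto_add_atTop_nat 1)) ?_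
  simp only [Function.comp_def, ampIter, fun k => laplace_picardStep hq hQ (measurable_ampIter hq k)
    (measurable_majSup Q) (enorm_ampIter_le_majSup hQ k) hre
    (lintegral_majSup_mul_enorm_laplaceKernel_ne_top hκ) x]
  refine tendsto_integral_of_dominated_convergence
    (fun t => ‖laplaceKernel κ t‖ * (Q + majBound Q κ.re ^ 2)) (fun k => ?_) ?_ (fun k => ?_) ?_
  · have hn : Measurable fun t => laplace (fun α => (ampIter q k α (x + t) : ℂ)) κ :=
      (measurable_laplace (B := fun α y => (ampIter q k α y : ℂ))
        (Complex.measurable_ofReal.comp (measurable_ampIter hq k)) κ).comp (measurable_const_add x)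
    exact Measurable.aestronglyMeasurable (by fun_prop)
  · exact (integrableOn_laplaceKernel hre 0).norm.mul_const _
  · refine ae_of_all _ fun t => ?_
    rw [norm_mul]
    gcongr
    refine norm_sub_sq_le_of_norm_le (hQ _) (norm_laplace_le_majBound (ae_of_all _ fun α => ?_) hκ)
    rw [enorm_complex_ofReal]
    exact enorm_ampIter_le_majSup hQ k α _
  · exact ae_of_all _ fun t =>
      (((tendsto_laplace_ampIter hq hQ hκ (x + t)).pow 2).const_sub _).const_mul _

lemma integral_Ioi_comp_const_add {E : Type*} [NormedAddCommGroup E] [NormedSpace ℝ E] (f : ℝ → E)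
    (c x : ℝ) : ∫ t in Ioi x, f (c + t) = ∫ t in Ioi (c + x), f t := by
  rw [← integral_indicator measurableSet_Ioi, ← integral_indicator measurableSet_Ioi,
    ← integral_add_left_eq_self ((Ioi (c + x)).indicator f) c]
  simp only [indicator_apply, mem_Ioi, add_lt_add_iff_left]

/-- The integrand of the Riccati equation `n' = 2κn + n² - q`, written as `(n e^{-2κx})' = -g`. -/
def riccatiSource (q : ℝ → ℝ) (κ : ℂ) (t : ℝ) : ℂ :=
  laplaceKernel κ t * (q t - riccati q κ t ^ 2)

lemma integrableOn_riccatiSource (hq : Measurable q) (hQ : ∀ x, ‖q x‖ₑ ≤ Q)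
    (hκ : √(Q : ℝ) < κ.re) (a : ℝ) : IntegrableOn (riccatiSource q κ) (Ioi a) := by
  have hn := measurable_riccati hq κ
  exact integrableOn_laplaceKernel_mul ((Real.sqrt_nonneg _).trans_lt hκ) (by fun_prop)
    (fun t => norm_sub_sq_le_of_norm_le (hQ t) (norm_riccati_le hq hQ hκ t)) a

lemma intervalIntegrable_riccatiSource (hq : Measurable q) (hQ : ∀ x, ‖q x‖ₑ ≤ Q)
    (hκ : √(Q : ℝ) < κ.re) (a b : ℝ) : IntervalIntegrable (riccatiSource q κ) volume a b :=
  ⟨(integrableOn_riccatiSource hq hQ hκ a).mono_set Ioc_subset_Ioi_self,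
    (integrableOn_riccatiSource hq hQ hκ b).mono_set Ioc_subset_Ioi_self⟩

lemma riccati_mul_laplaceKernel (hq : Measurable q) (hQ : ∀ x, ‖q x‖ₑ ≤ Q)
    (hκ : √(Q : ℝ) < κ.re) (x : ℝ) : riccati q κ x * laplaceKernel κ x =
      riccati q κ 0 * laplaceKernel κ 0 + ∫ t in (0 : ℝ)..x, -riccatiSource q κ t := by
  have tail : ∀ y, riccati q κ y * laplaceKernel κ y = ∫ t in Ioi y, riccatiSource q κ t :=
    fun y => by
      have hshift := integral_Ioi_comp_const_add (riccatiSource q κ) y 0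
      rw [add_zero] at hshift
      rw [riccati_eq_integral_Ioi hq hQ hκ, ← hshift, ← integral_mul_const]
      simp only [riccatiSource, laplaceKernel_add]
      congr with t
      ring
  rw [tail, tail, intervalIntegral.integral_neg, ← sub_eq_add_neg, eq_sub_iff_add_eq']
  exact intervalIntegral.integral_interval_add_Ioi (integrableOn_riccatiSource hq hQ hκ 0)
    (integrableOn_riccatiSource hq hQ hκ x)

lemma riccati_mul_laplaceKernel_mul_neg (q : ℝ → ℝ) (κ : ℂ) (x : ℝ) :
    riccati q κ x * laplaceKernel κ x * laplaceKernel κ (-x) = riccati q κ x := by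
  rw [mul_assoc, mul_comm (laplaceKernel κ x), laplaceKernel_neg_mul_cancel, mul_one]

lemma continuous_riccati (hq : Measurable q) (hQ : ∀ x, ‖q x‖ₑ ≤ Q) (hκ : √(Q : ℝ) < κ.re) :
    Continuous (riccati q κ) := by
  refine Continuous.congr ?_ (riccati_mul_laplaceKernel_mul_neg q κ)
  refine Continuous.mul ?_ ((continuous_laplaceKernel κ).comp continuous_neg)
  exact (continuous_const.add (intervalIntegral.continuous_primitive
    (fun a b => (intervalIntegrable_riccatiSource hq hQ hκ a b).neg) 0)).congr
    fun x => (riccati_mul_laplaceKernel hq hQ hκ x).symm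

lemma riccati_eq_add_integral (hq : Measurable q) (hQ : ∀ x, ‖q x‖ₑ ≤ Q) (hκ : √(Q : ℝ) < κ.re)
    (x : ℝ) : riccati q κ x = riccati q κ 0 +
      ∫ t in (0 : ℝ)..x, (2 * κ * riccati q κ t + riccati q κ t ^ 2 - q t) := by
  have hderiv : ∀ t, HasDerivAt (fun t => laplaceKernel κ (-t)) (2 * κ * laplaceKernel κ (-t)) t :=
    fun t => by
      simpa [Function.comp_def] using (hasDerivAt_laplaceKernel κ (-t)).scomp t (hasDerivAt_neg t)
  have hcont : Continuous fun t => 2 * κ * laplaceKernel κ (-t) :=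
    continuous_const.mul ((continuous_laplaceKernel κ).comp continuous_neg)
  have key := mul_eq_add_integral_of_eq_add_integral
    (F := fun t => riccati q κ t * laplaceKernel κ t) (G := fun t => laplaceKernel κ (-t))
    (intervalIntegrable_riccatiSource hq hQ hκ 0 x).neg (hcont.intervalIntegrable 0 x)
    (fun t _ => riccati_mul_laplaceKernel hq hQ hκ t) (fun t _ => by
      rw [intervalIntegral.integral_eq_sub_of_hasDerivAt (fun s _ => hderiv s)
        (hcont.intervalIntegrable 0 t), add_sub_cancel])
  simp only [riccati_mul_laplaceKernel_mul_neg] at key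
  rw [key]
  congr 1
  refine intervalIntegral.integral_congr fun t _ => ?_
  simp only [Pi.neg_apply, riccatiSource]
  linear_combination (2 * κ * riccati q κ t - (q t - riccati q κ t ^ 2)) *
    laplaceKernel_neg_mul_cancel κ t

end Riccati

section WeylSolution

variable {q : ℝ → ℝ} {Q : ℝ≥0} {κ : ℂ}

/-- The Weyl solution at `-κ²` whose logarithmic derivative is `-κ - n`, with the solution `n` of
the Riccati equation. -/
def weylSol (q : ℝ → ℝ) (κ : ℂ) (x : ℝ) : ℂ :=
  Complex.exp (-κ * x - ∫ t in (0 : ℝ)..x, riccati q κ t)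

/-- The derivative of `weylSol`. -/
def weylSolDeriv (q : ℝ → ℝ) (κ : ℂ) (x : ℝ) : ℂ := -(κ + riccati q κ x) * weylSol q κ x

lemma weylSol_ne_zero (q : ℝ → ℝ) (κ : ℂ) (x : ℝ) : weylSol q κ x ≠ 0 := Complex.exp_ne_zero _

lemma weylSolDeriv_zero_div (q : ℝ → ℝ) (κ : ℂ) :
    weylSolDeriv q κ 0 / weylSol q κ 0 = -κ - riccati q κ 0 := by
  rw [weylSolDeriv, mul_div_cancel_right₀ _ (weylSol_ne_zero q κ 0), neg_add']

lemma hasDerivAt_weylSol (hq : Measurable q) (hQ : ∀ x, ‖q x‖ₑ ≤ Q) (hκ : √(Q : ℝ) < κ.re)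
    (x : ℝ) : HasDerivAt (weylSol q κ) (weylSolDeriv q κ x) x := by
  have hlin : HasDerivAt (fun t : ℝ => -κ * (t : ℂ)) (-κ) x := by
    simpa using (Complex.ofRealCLM.hasDerivAt (x := x)).const_mul (-κ)
  have hint := ((continuous_riccati hq hQ hκ).integral_hasStrictDerivAt 0 x).hasDerivAt
  refine (hlin.sub hint).cexp.congr_deriv ?_
  rw [weylSolDeriv, weylSol, Pi.sub_apply]
  ring

lemma continuous_weylSol (hq : Measurable q) (hQ : ∀ x, ‖q x‖ₑ ≤ Q) (hκ : √(Q : ℝ) < κ.re) :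
    Continuous (weylSol q κ) :=
  continuous_iff_continuousAt.2 fun x => (hasDerivAt_weylSol hq hQ hκ x).continuousAt

lemma continuous_weylSolDeriv (hq : Measurable q) (hQ : ∀ x, ‖q x‖ₑ ≤ Q) (hκ : √(Q : ℝ) < κ.re) :
    Continuous (weylSolDeriv q κ) :=
  (continuous_const.add (continuous_riccati hq hQ hκ)).neg.mul (continuous_weylSol hq hQ hκ)

lemma norm_weylSol_le (hq : Measurable q) (hQ : ∀ x, ‖q x‖ₑ ≤ Q) (hκ : √(Q : ℝ) < κ.re) {x : ℝ}
    (hx : 0 ≤ x) : ‖weylSol q κ x‖ ≤ Real.exp (-(κ.re - majBound Q κ.re) * x) := by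
  have hint : ‖∫ t in (0 : ℝ)..x, riccati q κ t‖ ≤ majBound Q κ.re * |x - 0| :=
    intervalIntegral.norm_integral_le_of_norm_le_const fun t _ => norm_riccati_le hq hQ hκ t
  have hre := (abs_le.1 ((Complex.abs_re_le_norm _).trans hint)).1
  rw [sub_zero, abs_of_nonneg hx] at hre
  rw [weylSol, Complex.norm_exp, Real.exp_le_exp, Complex.sub_re, Complex.re_mul_ofReal,
    Complex.neg_re]
  linarith

lemma memLp_weylSol (hq : Measurable q) (hQ : ∀ x, ‖q x‖ₑ ≤ Q) (hκ : √(Q : ℝ) < κ.re) :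
    MemLp (weylSol q κ) 2 (volume.restrict (Ioi 0)) := by
  have hcont := continuous_weylSol hq hQ hκ
  refine (memLp_two_iff_integrable_sq_norm hcont.aestronglyMeasurable).2 ?_
  have hpos : 0 < 2 * (κ.re - majBound Q κ.re) := by linarith [majBound_lt hκ]
  refine (exp_neg_integrableOn_Ioi 0 hpos).mono' (hcont.norm.pow 2).aestronglyMeasurable ?_
  filter_upwards [ae_restrict_mem measurableSet_Ioi] with x hx
  rw [norm_pow, norm_norm]
  calc ‖weylSol q κ x‖ ^ 2 ≤ Real.exp (-(κ.re - majBound Q κ.re) * x) ^ 2 := by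
        gcongr
        exact norm_weylSol_le hq hQ hκ (le_of_lt hx)
    _ = Real.exp (-(2 * (κ.re - majBound Q κ.re)) * x) := by
        rw [← Real.exp_nat_mul]
        push_cast
        ring_nf

lemma memLp_weylSolDeriv (hq : Measurable q) (hQ : ∀ x, ‖q x‖ₑ ≤ Q) (hκ : √(Q : ℝ) < κ.re) :
    MemLp (weylSolDeriv q κ) 2 (volume.restrict (Ioi 0)) := by
  refine (memLp_weylSol hq hQ hκ).of_le_mul (c := ‖κ‖ + majBound Q κ.re)
    (continuous_weylSolDeriv hq hQ hκ).aestronglyMeasurable (ae_of_all _ fun x => ?_)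
  rw [weylSolDeriv, norm_mul, norm_neg]
  gcongr
  exact (norm_add_le _ _).trans (add_le_add le_rfl (norm_riccati_le hq hQ hκ x))

lemma intervalIntegrable_of_norm_le {E : Type*} [NormedAddCommGroup E] {f : ℝ → E}
    (hf : AEStronglyMeasurable f) {C : ℝ} (hC : ∀ t, ‖f t‖ ≤ C) (a b : ℝ) :
    IntervalIntegrable f volume a b :=
  (intervalIntegrable_const (c := C)).mono_fun hf.restrict
    (ae_of_all _ fun t => (hC t).trans (le_abs_self C))

lemma weylSolDeriv_eq_add_integral (hq : Measurable q) (hQ : ∀ x, ‖q x‖ₑ ≤ Q)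
    (hκ : √(Q : ℝ) < κ.re) (x : ℝ) : weylSolDeriv q κ x =
      weylSolDeriv q κ 0 + ∫ t in (0 : ℝ)..x, (q t - -κ ^ 2) * weylSol q κ t := by
  have hcont := continuous_riccati hq hQ hκ
  have hqint : IntervalIntegrable (fun t => (q t : ℂ)) volume 0 x :=
    intervalIntegrable_of_norm_le (by fun_prop : Measurable _).aestronglyMeasurable
      (fun t => norm_complex_ofReal_le_of_enorm_le (hQ t)) 0 x
  have hnint : IntervalIntegrable (fun t => -(2 * κ * riccati q κ t + riccati q κ t ^ 2 - q t))
      volume 0 x :=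
    (((by fun_prop : Continuous fun t => 2 * κ * riccati q κ t +
      riccati q κ t ^ 2).intervalIntegrable 0 x).sub hqint).neg
  have hsol := continuous_weylSolDeriv hq hQ hκ
  have key := mul_eq_add_integral_of_eq_add_integral (F := fun t => -(κ + riccati q κ t))
    (G := weylSol q κ) hnint (hsol.intervalIntegrable 0 x)
    (fun t _ => by
      rw [intervalIntegral.integral_neg, riccati_eq_add_integral hq hQ hκ t]
      ring)
    (fun t _ => by
      rw [intervalIntegral.integral_eq_sub_of_hasDerivAt
        (fun s _ => hasDerivAt_weylSol hq hQ hκ s) (hsol.intervalIntegrable 0 t), add_sub_cancel])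
  change weylSolDeriv q κ x = weylSolDeriv q κ 0 + _ at key
  rw [key]
  congr 1
  refine intervalIntegral.integral_congr fun t _ => ?_
  simp only [weylSolDeriv]
  ring

lemma isWeylSolution_weylSol (hq : Measurable q) (hQ : ∀ x, ‖q x‖ₑ ≤ Q) (hκ : √(Q : ℝ) < κ.re) :
    IsWeylSolution q (-κ ^ 2) (weylSol q κ) (weylSolDeriv q κ) where
  hasDeriv x _ := (hasDerivAt_weylSol hq hQ hκ x).hasDerivWithinAt
  equation x _ := weylSolDeriv_eq_add_integral hq hQ hκ x
  nonzero := ⟨0, self_mem_Ici, weylSol_ne_zero q κ 0⟩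
  memLp := memLp_weylSol hq hQ hκ

end WeylSolution

section SectorAtInfinity

lemma arg_one_sub_I : (1 - Complex.I).arg = -(Real.pi / 4) := by
  have hpi := Real.pi_pos
  have hpolar : 1 - Complex.I = ((√2 : ℝ) : ℂ) * (Complex.cos ((-(Real.pi / 4) : ℝ) : ℂ) +
      Complex.sin ((-(Real.pi / 4) : ℝ) : ℂ) * Complex.I) := by
    rw [← Complex.ofReal_cos, ← Complex.ofReal_sin, Real.cos_neg, Real.sin_neg,
      Real.cos_pi_div_four, Real.sin_pi_div_four]
    have hsqrt : √2 * (√2 / 2) = (1 : ℝ) := by rw [← mul_div_assoc, Real.mul_self_sqrt] <;> norm_num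
    apply Complex.ext <;> simp [hsqrt]
  rw [hpolar]
  exact Complex.arg_mul_cos_add_sin_mul_I (by positivity) ⟨by linarith, by linarith⟩

lemma tendsto_ray_sectorAtInfinity {ε : ℝ} (hε : ε < Real.pi / 4) :
    Tendsto (fun r : ℝ => (r : ℂ) * (1 - Complex.I)) atTop (sectorAtInfinity ε) := by
  refine tendsto_inf.2 ⟨?_, tendsto_principal.2 ?_⟩
  · have hne : 0 < ‖1 - Complex.I‖ := norm_pos_iff.2 fun h => by simpa using congrArg Complex.re h
    refine tendsto_norm_atTop_iff_cobounded.1 ?_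
    simp_rw [norm_mul, Complex.norm_real]
    exact tendsto_norm_atTop_atTop.atTop_mul_const hne
  · filter_upwards [eventually_gt_atTop 0] with r hr
    rw [Complex.arg_real_mul _ hr, arg_one_sub_I]
    constructor <;> linarith

lemma tendsto_re_sectorAtInfinity {ε : ℝ} (hε : 0 < ε) :
    Tendsto Complex.re (sectorAtInfinity ε) atTop := by
  rcases lt_or_ge ε (Real.pi / 2) with h | h
  · have hsin : 0 < Real.sin ε := Real.sin_pos_of_pos_of_lt_pi hε (by linarith)
    have hlim : Tendsto (fun κ : ℂ => ‖κ‖ * Real.sin ε) (sectorAtInfinity ε) atTop :=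
      (tendsto_norm_cobounded_atTop.mono_left inf_le_left).atTop_mul_const hsin
    refine tendsto_atTop_mono' _ (mem_inf_of_right (mem_principal.2 fun κ hκ => ?_)) hlim
    change ‖κ‖ * Real.sin ε ≤ κ.re
    rw [← Complex.norm_mul_cos_arg κ, ← Real.cos_pi_div_two_sub, ← Real.cos_abs κ.arg]
    gcongr
    exact Real.cos_le_cos_of_nonneg_of_le_pi (abs_nonneg _) (by linarith)
      (abs_le.2 ⟨by linarith [hκ.1], by linarith [hκ.2]⟩)
  · have hempty : {κ : ℂ | -(Real.pi / 2) + ε < κ.arg ∧ κ.arg < -ε} = ∅ :=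
      eq_empty_of_forall_notMem fun κ hκ => by linarith [hκ.1, hκ.2]
    rw [sectorAtInfinity, hempty, principal_empty, inf_bot_eq]
    exact tendsto_bot

end SectorAtInfinity

section OTilde

open Asymptotics

variable {l : Filter ℂ} {f g : ℂ → ℂ}

lemma isOTilde_of_isBigO (hg : Tendsto g l (𝓝 0)) (hfg : f =O[l] g) : IsOTilde l f g := by
  refine ⟨hg, fun ε hε => (isLittleO_one_iff ℂ).1 ?_⟩
  have hdiv : (fun κ => f κ / g κ) =O[l] fun _ => (1 : ℂ) := by
    obtain ⟨C, hC, hbound⟩ := hfg.exists_nonneg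
    refine IsBigO.of_bound C (hbound.bound.mono fun κ h => ?_)
    rw [norm_div, norm_one, mul_one]
    exact div_le_of_le_mul₀ (norm_nonneg _) hC h
  have hpow : Tendsto (fun κ => ((‖g κ‖ ^ ε : ℝ) : ℂ)) l (𝓝 0) := by
    have h := hg.norm.rpow_const (p := ε) (Or.inr hε.le)
    rw [norm_zero, Real.zero_rpow hε.ne'] at h
    exact_mod_cast (Complex.continuous_ofReal.tendsto 0).comp h
  simpa using hdiv.mul_isLittleO ((isLittleO_one_iff ℂ).2 hpow)

lemma IsOTilde.isBigO_rpow (h : IsOTilde l f g) (hg : ∀ κ, g κ ≠ 0) {s : ℝ} (hs : s < 1) :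
    f =O[l] fun κ => ‖g κ‖ ^ s := by
  have hone := (h.2 (1 - s) (sub_pos.2 hs)).isBigO_one ℝ
  refine isBigO_norm_left.1 ((hone.norm_left.mul (isBigO_refl (fun κ => ‖g κ‖ ^ s) l)).congr
    (fun κ => ?_) fun κ => one_mul _)
  have hpos := norm_pos_iff.2 (hg κ)
  rw [norm_mul, norm_div, Complex.norm_real, Real.norm_of_nonneg (by positivity), mul_assoc,
    ← Real.rpow_add hpos, sub_add_cancel, Real.rpow_one, div_mul_cancel₀ _ hpos.ne']

end OTilde

section AAmplitude

open Asymptotics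

variable {κ : ℂ} {f : ℝ → ℂ}

lemma laplace_indicator {s : Set ℝ} (hs : MeasurableSet s) (f : ℝ → ℂ) (κ : ℂ) :
    laplace (s.indicator f) κ = ∫ α in s, f α * laplaceKernel κ α := by
  rw [← integral_indicator hs, laplace]
  simp_rw [indicator_mul_left]

lemma laplace_eq_setIntegral_Ioi (hf0 : ∀ α ≤ 0, f α = 0) (κ : ℂ) :
    laplace f κ = ∫ α in Ioi 0, f α * laplaceKernel κ α :=
  (setIntegral_eq_integral_of_forall_compl_eq_zero fun α hα => by
    rw [hf0 α (not_lt.1 hα), zero_mul]).symm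

lemma laplace_eq_intervalIntegral_add (hf0 : ∀ α ≤ 0, f α = 0)
    (hf : Integrable fun α => f α * laplaceKernel κ α) (a : ℝ) :
    laplace f κ = (∫ α in (0 : ℝ)..a, f α * laplaceKernel κ α) +
      laplace ((Ioi a).indicator f) κ := by
  rw [laplace_eq_setIntegral_Ioi hf0, laplace_indicator measurableSet_Ioi]
  exact (intervalIntegral.integral_interval_add_Ioi hf.integrableOn hf.integrableOn).symm

lemma laplace_indicator_Ioc_eq_sub {a b c : ℝ} (hab : a ≤ b) (hbc : b ≤ c)
    (hf : IntervalIntegrable f volume a c) (κ : ℂ) : laplace ((Ioc a b).indicator f) κ =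
      (∫ α in a..c, f α * laplaceKernel κ α) - laplace ((Ioc b c).indicator f) κ := by
  have hfK : IntervalIntegrable (fun α => f α * laplaceKernel κ α) volume a c :=
    hf.mul_continuousOn (continuous_laplaceKernel κ).continuousOn
  rw [laplace_indicator measurableSet_Ioc, laplace_indicator measurableSet_Ioc,
    ← intervalIntegral.integral_of_le hab, ← intervalIntegral.integral_of_le hbc,
    ← intervalIntegral.integral_add_adjacent_intervals
      (hfK.mono_set (uIcc_subset_uIcc_left (mem_uIcc_of_le hab hbc)))
      (hfK.mono_set (uIcc_subset_uIcc_right (mem_uIcc_of_le hab hbc))), add_sub_cancel_right]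

lemma integrableOn_of_integrable_mul_laplaceKernel
    (hf : Integrable fun α => f α * laplaceKernel κ α) (a b : ℝ) : IntegrableOn f (Icc a b) := by
  refine (hf.integrableOn.mul_continuousOn ((continuous_laplaceKernel κ).comp
    continuous_neg).continuousOn isCompact_Icc).congr_fun (fun α _ => ?_) measurableSet_Icc
  simp only [Function.comp_apply]
  linear_combination f α * laplaceKernel_neg_mul_cancel κ α

lemma tendsto_laplaceKernel_sectorAtInfinity {a ε : ℝ} (ha : 0 < a) (hε : 0 < ε) :
    Tendsto (fun κ => laplaceKernel κ a) (sectorAtInfinity ε) (𝓝 0) := by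
  refine tendsto_zero_iff_norm_tendsto_zero.2 ?_
  have hre : Tendsto (fun κ : ℂ => -2 * a * κ.re) (sectorAtInfinity ε) atBot :=
    (tendsto_re_sectorAtInfinity hε).const_mul_atTop_of_neg (by linarith)
  simpa only [norm_laplaceKernel] using! Real.tendsto_exp_atBot.comp hre

lemma isBigO_laplace_of_eq_zero {l : Filter ℂ} (hl : Tendsto Complex.re l atTop) {a : ℝ} {c : ℂ}
    (hf0 : ∀ α ≤ a, f α = 0) (hf : Integrable fun α => f α * laplaceKernel c α) :
    laplace f =O[l] fun κ => laplaceKernel κ a := by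
  refine IsBigO.of_bound (Real.exp (2 * a * c.re) * ∫ α, ‖f α * laplaceKernel c α‖) ?_
  filter_upwards [hl.eventually_ge_atTop c.re] with κ hκ
  refine (norm_laplace_le_of_eq_zero hf0 hf hκ).trans_eq ?_
  rw [norm_laplaceKernel, mul_right_comm (Real.exp _), ← Real.exp_add]
  congr 2
  ring

lemma isAAmplitude_of_weylM_eq {q A : ℝ → ℝ} {c : ℂ} (hA0 : ∀ α ≤ 0, A α = 0)
    (hA : Integrable fun α => (A α : ℂ) * laplaceKernel c α)
    (hm : ∀ κ : ℂ, c.re ≤ κ.re → weylM q (-κ ^ 2) = -κ - laplace (fun α => A α) κ) :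
    IsAAmplitude q A where
  integrable a _ := by
    simpa using! ((integrableOn_of_integrable_mul_laplaceKernel hA 0 a).mono_set
      Ioo_subset_Icc_self).re
  asymptotics a ha ε hε := by
    have hre := tendsto_re_sectorAtInfinity hε
    refine isOTilde_of_isBigO (tendsto_laplaceKernel_sectorAtInfinity ha hε) ?_
    have htail : laplace ((Ioi a).indicator fun α => (A α : ℂ)) =O[sectorAtInfinity ε]
        fun κ => laplaceKernel κ a := by
      refine isBigO_laplace_of_eq_zero hre (c := c)
        (fun α hα => indicator_of_notMem (not_lt.2 hα) _) ?_
      exact (hA.indicator measurableSet_Ioi).congr (ae_of_all _ fun α => indicator_mul_left ..)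
    refine htail.neg_left.congr' ?_ EventuallyEq.rfl
    filter_upwards [hre.eventually_ge_atTop c.re] with κ hκ
    rw [hm κ hκ, laplace_eq_intervalIntegral_add (fun α hα => by rw [hA0 α hα, Complex.ofReal_zero])
      (integrable_mul_laplaceKernel_of_re_le (fun α hα => by rw [hA0 α hα.le, Complex.ofReal_zero])
        hA hκ) a]
    simp only [laplaceKernel]
    ring

lemma ae_eq_zero_of_isBigO_laplace {f : ℝ → ℝ} {b : ℝ} (hf : Integrable f)
    (hfb : ∀ α ∉ Ioc 0 b, f α = 0)
    (hO : (fun r : ℝ => laplace (fun α => f α) (r * (1 - Complex.I))) =O[atTop]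
      fun r : ℝ => laplaceKernel (r * (1 - Complex.I)) b) : f =ᵐ[volume] 0 := by
  have hshift : ∀ κ, laplace (fun α => (f (α + b) : ℂ)) κ =
      laplaceKernel κ (-b) * laplace (fun α => f α) κ := fun κ => by
    simp only [← laplace_comp_sub_right, sub_neg_eq_add]
  obtain ⟨C, hC⟩ := hO.bound
  obtain ⟨r₀, hr₀⟩ := eventually_atTop.1 hC
  have hzero := ae_eq_zero_of_laplace_bounded_on_ray (hf.comp_add_right b) (b := b)
    (fun α hα => hfb _ fun h => hα ⟨by linarith [h.1], by linarith [h.2]⟩) (C := C)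
    (r₀ := r₀) fun r hr => by
      rw [hshift, norm_mul]
      calc _ ≤ ‖laplaceKernel (r * (1 - Complex.I)) (-b)‖ *
            (C * ‖laplaceKernel (r * (1 - Complex.I)) b‖) := by
            gcongr
            exact hr₀ r hr
        _ = C := by rw [mul_left_comm, ← norm_mul, laplaceKernel_neg_mul_cancel, norm_one, mul_one]
  have h := (measurePreserving_sub_right volume b).quasiMeasurePreserving.ae hzero
  simpa only [sub_add_cancel] using! h

namespace IsAAmplitude

variable {q A A' : ℝ → ℝ}

lemma intervalIntegrable (hA : IsAAmplitude q A) {a : ℝ} (ha : 0 < a) :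
    IntervalIntegrable A volume 0 a :=
  (intervalIntegrable_iff_integrableOn_Ioo_of_le ha.le).2 (hA.integrable a ha)

lemma isBigO_integral_sub (hA : IsAAmplitude q A) (hA' : IsAAmplitude q A') {b ε : ℝ} (hb : 0 < b)
    (hε : 0 < ε) : (fun κ => ∫ α in (0 : ℝ)..2 * b, ((A α - A' α : ℝ) : ℂ) * laplaceKernel κ α)
      =O[sectorAtInfinity ε] fun κ => laplaceKernel κ b := by
  have hO : ∀ B, IsAAmplitude q B → (fun κ => weylM q (-κ ^ 2) -
      (-κ - ∫ α in (0 : ℝ)..2 * b, (B α : ℂ) * laplaceKernel κ α))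
        =O[sectorAtInfinity ε] fun κ => laplaceKernel κ b := fun B hB => by
    refine ((hB.asymptotics (2 * b) (by positivity) ε hε).isBigO_rpow
      (fun κ => Complex.exp_ne_zero _) one_half_lt_one).congr_right (fun κ => ?_) |>.of_norm_right
    change ‖laplaceKernel κ (2 * b : ℝ)‖ ^ (1 / 2 : ℝ) = ‖laplaceKernel κ b‖
    rw [norm_laplaceKernel, norm_laplaceKernel, ← Real.exp_mul]
    ring_nf
  have hint : ∀ B, IsAAmplitude q B → ∀ κ,
      IntervalIntegrable (fun α => (B α : ℂ) * laplaceKernel κ α) volume 0 (2 * b) := fun B hB κ =>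
    have h := hB.intervalIntegrable (a := 2 * b) (by positivity)
    have hofReal : IntervalIntegrable (fun α => (B α : ℂ)) volume 0 (2 * b) :=
      ⟨h.1.ofReal, h.2.ofReal⟩
    hofReal.mul_continuousOn (continuous_laplaceKernel κ).continuousOn
  refine ((hO A hA).sub (hO A' hA')).congr_left fun κ => ?_
  simp_rw [Complex.ofReal_sub, sub_mul]
  rw [intervalIntegral.integral_sub (hint A hA κ) (hint A' hA' κ)]
  ring

lemma indicator_Ioc_ae_eq_zero (hA : IsAAmplitude q A) (hA' : IsAAmplitude q A') {b : ℝ}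
    (hb : 0 < b) : (Ioc 0 b).indicator (fun α => A α - A' α) =ᵐ[volume] 0 := by
  set f : ℝ → ℝ := fun α => A α - A' α
  have hf : IntervalIntegrable f volume 0 (2 * b) :=
    (hA.intervalIntegrable (by positivity)).sub (hA'.intervalIntegrable (by positivity))
  have hofReal : ∀ s : Set ℝ,
      s.indicator (fun α => (f α : ℂ)) = fun α => ((s.indicator f α : ℝ) : ℂ) :=
    fun s => indicator_comp_of_zero Complex.ofReal_zero
  have hε : 0 < Real.pi / 8 := by positivity
  have htail : laplace ((Ioc b (2 * b)).indicator fun α => (f α : ℂ))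
      =O[sectorAtInfinity (Real.pi / 8)] fun κ => laplaceKernel κ b := by
    refine isBigO_laplace_of_eq_zero (tendsto_re_sectorAtInfinity hε) (c := 0)
      (fun α hα => indicator_of_notMem (fun h => hα.not_gt h.1) _) ?_
    simpa [laplaceKernel, hofReal] using! ((hf.1.mono_set
      (Ioc_subset_Ioc_left hb.le)).integrable_indicator measurableSet_Ioc).ofReal
  refine ae_eq_zero_of_isBigO_laplace ((hf.1.mono_set (Ioc_subset_Ioc_right
    (by linarith))).integrable_indicator measurableSet_Ioc)
    (fun α hα => indicator_of_notMem hα _) ?_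
  refine (((hA.isBigO_integral_sub hA' hb hε).sub htail).comp_tendsto
    (tendsto_ray_sectorAtInfinity (by linarith))).congr_left fun r => ?_
  rw [← hofReal]
  exact (laplace_indicator_Ioc_eq_sub hb.le (by linarith) ⟨hf.1.ofReal, hf.2.ofReal⟩ _).symm

lemma ae_eq (hA : IsAAmplitude q A) (hA' : IsAAmplitude q A') :
    A =ᵐ[volume.restrict (Ioi 0)] A' := by
  rw [EventuallyEq, ae_restrict_iff' measurableSet_Ioi]
  filter_upwards [ae_all_iff.2 fun n : ℕ => hA.indicator_Ioc_ae_eq_zero hA' n.cast_add_one_pos]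
    with α hα hpos
  obtain ⟨n, hn⟩ := exists_nat_ge α
  have h := hα n
  rw [indicator_of_mem (mem_Ioc.2 ⟨hpos, hn.trans (by linarith)⟩)] at h
  exact sub_eq_zero.1 h

end IsAAmplitude

end AAmplitude

section BoundedPotential

lemma exists_measurable_enorm_le_ae_eq {X E : Type*} [MeasurableSpace X] [NormedAddCommGroup E]
    [MeasurableSpace E] [BorelSpace E] {μ : Measure X} {f : X → E} (hf : AEMeasurable f μ) :
    ∃ g, Measurable g ∧ (∀ x, ‖g x‖ₑ ≤ eLpNorm f ⊤ μ) ∧ f =ᵐ[μ] g := by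
  obtain ⟨g, hg, hrange, hfg⟩ := hf.exists_ae_eq_range_subset
    (t := {y | ‖y‖ₑ ≤ eLpNorm f ⊤ μ})
    (by simpa only [eLpNorm_exponent_top] using! enorm_ae_le_eLpNormEssSup f μ)
    ⟨0, by simp⟩
  exact ⟨g, hg, fun x => hrange (mem_range_self x), hfg⟩

variable {q p : ℝ → ℝ} {Q : ℝ≥0} {κ : ℂ}

lemma locallyIntegrableOn_of_memLp_top (hq : MemLp q ⊤ (volume.restrict (Ioi 0))) :
    LocallyIntegrableOn q (Ici 0) := by
  rw [Measure.restrict_congr_set Ioi_ae_eq_Ici] at hq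
  exact locallyIntegrableOn_of_locallyIntegrable_restrict (hq.locallyIntegrable le_top)

lemma weylM_eq_neg_sub_riccati (hq : LocallyIntegrableOn q (Ici 0))
    (hqp : q =ᵐ[volume.restrict (Ioi 0)] p) (hp : Measurable p) (hQ : ∀ x, ‖p x‖ₑ ≤ Q)
    (hκ : √(Q : ℝ) < κ.re) : weylM q (-κ ^ 2) = -κ - riccati p κ 0 := by
  rw [((isWeylSolution_weylSol hp hQ hκ).congr hqp.symm).weylM_eq hq
    (memLp_weylSolDeriv hp hQ hκ) fun x _ => weylSol_ne_zero p κ x, weylSolDeriv_zero_div]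

lemma isAAmplitude_amp (hq : LocallyIntegrableOn q (Ici 0))
    (hqp : q =ᵐ[volume.restrict (Ioi 0)] p) (hp : Measurable p) (hQ : ∀ x, ‖p x‖ₑ ≤ Q) :
    IsAAmplitude q fun α => amp p α 0 := by
  have hc : √(Q : ℝ) < ((√(Q : ℝ) + 1 : ℝ) : ℂ).re := by simp
  exact isAAmplitude_of_weylM_eq (fun α hα => amp_of_nonpos p hα 0)
    (integrable_amp_mul_laplaceKernel hp hQ hc 0)
    fun κ hκ => weylM_eq_neg_sub_riccati hq hqp hp hQ (hc.trans_le hκ)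

lemma analyticAt_riccati (hp : Measurable p) (hQ : ∀ x, ‖p x‖ₑ ≤ Q) (hκ : √(Q : ℝ) < κ.re)
    (x : ℝ) : AnalyticAt ℂ (fun w => riccati p w x) κ := by
  refine DifferentiableOn.analyticAt (s := {w | √(Q : ℝ) < w.re}) (fun w hw => ?_)
    ((isOpen_lt continuous_const Complex.continuous_re).mem_nhds hκ)
  obtain ⟨b, hQb, hbw⟩ := exists_between (show √(Q : ℝ) < w.re from hw)
  exact (differentiableAt_laplace_of_re_lt (c := b)
    (fun α hα => by rw [amp_of_nonpos p hα.le, Complex.ofReal_zero])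
    (integrable_amp_mul_laplaceKernel hp hQ hQb x) hbw).differentiableWithinAt

lemma sq_mem_slitPlane (hκ : 0 < κ.re) : κ ^ 2 ∈ Complex.slitPlane := by
  rw [Complex.mem_slitPlane_iff, pow_two, Complex.mul_re, Complex.mul_im]
  rcases eq_or_ne κ.im 0 with h | h
  · left
    rw [h]
    nlinarith
  · right
    rw [mul_comm κ.im, ← two_mul]
    exact mul_ne_zero two_ne_zero (mul_ne_zero hκ.ne' h)

lemma analyticAt_of_comp_neg_sq {m f : ℂ → ℂ} (hκ : 0 < κ.re) (hf : AnalyticAt ℂ f κ)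
    (hm : ∀ᶠ w in 𝓝 κ, m (-w ^ 2) = f w) : AnalyticAt ℂ m (-κ ^ 2) := by
  set s : ℂ → ℂ := fun z => (-z) ^ (2⁻¹ : ℂ)
  have hs : AnalyticAt ℂ s (-κ ^ 2) :=
    analyticAt_id.neg.cpow analyticAt_const (by simpa using! sq_mem_slitPlane hκ)
  have hsκ : s (-κ ^ 2) = κ := by simp only [s, neg_neg, Complex.sq_cpow_two_inv hκ]
  have hlim : Tendsto s (𝓝 (-κ ^ 2)) (𝓝 κ) := by simpa only [hsκ] using hs.continuousAt.tendsto
  refine (hf.comp_of_eq hs hsκ).congr ?_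
  filter_upwards [hlim.eventually hm] with z hz
  rw [Function.comp_apply, ← hz, Complex.cpow_ofNat_inv_pow, neg_neg]

end BoundedPotential

end Schrodinger

end

open Schrodinger in
theorem theorem10p3_general (q : ℝ → ℝ) (hq : MemLp q ⊤ (volume.restrict (Ioi (0 : ℝ)))) :
    (∃ A : ℝ → ℝ, IsAAmplitude q A) ∧
    ∀ A : ℝ → ℝ, IsAAmplitude q A → ∀ κ : ℂ, 0 < κ.re →
      (eLpNorm q ⊤ (volume.restrict (Ioi (0 : ℝ)))).toReal < κ.re ^ 2 →
        (∃ u u' : ℝ → ℂ, IsWeylSolution q (-κ ^ 2) u u') ∧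
        (∀ u u' : ℝ → ℂ, IsWeylSolution q (-κ ^ 2) u u' →
          u 0 ≠ 0 ∧ u' 0 / u 0 = weylM q (-κ ^ 2)) ∧
        AnalyticAt ℂ (weylM q) (-κ ^ 2) ∧
        IntegrableOn (fun α : ℝ => (A α : ℂ) * Complex.exp (-2 * α * κ)) (Ioi 0) ∧
        weylM q (-κ ^ 2) = -κ - ∫ α in Ioi (0 : ℝ), (A α : ℂ) * Complex.exp (-2 * α * κ) := by
  obtain ⟨p, hp, hpQ, hqp⟩ := exists_measurable_enorm_le_ae_eq hq.1.aemeasurable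
  rw [← ENNReal.coe_toNNReal hq.2.ne] at hpQ
  have hloc := locallyIntegrableOn_of_memLp_top hq
  have hamp := isAAmplitude_amp hloc hqp hp hpQ
  refine ⟨⟨_, hamp⟩, fun A hA κ hpos hκ => ?_⟩
  have hlt := (Real.sqrt_lt' hpos).2 hκ
  have hre : ∀ᶠ w in 𝓝 κ, √(eLpNorm q ⊤ (volume.restrict (Ioi 0))).toReal < w.re :=
    Complex.continuous_re.continuousAt.eventually_const_lt hlt
  have hm : ∀ w : ℂ, _ → weylM q (-w ^ 2) = -w - riccati p w 0 := fun w =>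
    weylM_eq_neg_sub_riccati hloc hqp hp hpQ
  have hu := (isWeylSolution_weylSol hp hpQ hlt).congr hqp.symm
  have hu' := memLp_weylSolDeriv hp hpQ hlt
  have hne : ∀ x, 0 ≤ x → weylSol p κ x ≠ 0 := fun x _ => weylSol_ne_zero p κ x
  have hAp : (fun α => (A α : ℂ) * laplaceKernel κ α) =ᵐ[volume.restrict (Ioi 0)]
      fun α => (amp p α 0 : ℂ) * laplaceKernel κ α :=
    (hA.ae_eq hamp).mono fun α h => by simp only [h]
  refine ⟨⟨_, _, hu⟩, fun v v' hv => ⟨hu.apply_zero_ne_zero hv hloc hu' hne, ?_⟩, ?_, ?_, ?_⟩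
  · rw [hu.div_zero_eq_div_zero hv hloc hu' hne, hu.weylM_eq hloc hu' hne]
  · exact analyticAt_of_comp_neg_sq hpos
      (analyticAt_id.neg.sub (analyticAt_riccati hp hpQ hlt 0)) (hre.mono hm)
  · exact (integrable_amp_mul_laplaceKernel hp hpQ hlt 0).integrableOn.congr hAp.symm
  · rw [hm κ hlt, riccati, laplace_eq_setIntegral_Ioi fun α hα => by
      rw [amp_of_nonpos p hα, Complex.ofReal_zero]]
    exact congrArg _ (integral_congr_ae hAp).symm

theorem theorem10p3 (q : ℝ → ℝ) (hq : MemLp q ⊤ (volume.restrict (Ioi (0 : ℝ)))) :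
    (∃ A : ℝ → ℝ, Schrodinger.IsAAmplitude q A) ∧
    ∀ A : ℝ → ℝ, Schrodinger.IsAAmplitude q A →
      ∀ κ : ℝ, 0 < κ → (eLpNorm q ⊤ (volume.restrict (Ioi (0 : ℝ)))).toReal < κ ^ 2 →
        -- the value of m at the real point -κ² is well defined by the Weyl solutions there
        (∃ u u' : ℝ → ℂ, Schrodinger.IsWeylSolution q (-(κ : ℂ) ^ 2) u u') ∧
        (∀ u u' : ℝ → ℂ, Schrodinger.IsWeylSolution q (-(κ : ℂ) ^ 2) u u' →
          u 0 ≠ 0 ∧ u' 0 / u 0 = Schrodinger.weylM q (-(κ : ℂ) ^ 2)) ∧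
        -- and is the analytic continuation of m from the upper half plane
        AnalyticAt ℂ (Schrodinger.weylM q) (-(κ : ℂ) ^ 2) ∧
        -- the integral converges and there is no error term
        IntegrableOn (fun α : ℝ => A α * Real.exp (-2 * α * κ)) (Ioi 0) ∧
        Schrodinger.weylM q (-(κ : ℂ) ^ 2) =
          ((-κ - ∫ α in Ioi (0 : ℝ), A α * Real.exp (-2 * α * κ) : ℝ) : ℂ) := by
  refine ⟨(theorem10p3_general q hq).1, fun A hA κ hpos hκ => ?_⟩
  have hcast : ∀ α : ℝ, (A α : ℂ) * Complex.exp (-2 * α * κ) =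
      ((A α * Real.exp (-2 * α * κ) : ℝ) : ℂ) := fun α => by push_cast; rfl
  obtain ⟨hex, hquot, hanal, hint, hm⟩ :=
    (theorem10p3_general q hq).2 A hA κ (by simpa) (by simpa)
  simp only [hcast, integral_complex_ofReal] at hint hm
  exact ⟨hex, hquot, hanal, hint.re, by rw [hm]; push_cast; rfl⟩
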